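/- Let $N\ge 1$ and $K$ be integers, $\sigma>0$, and for $k=1,\dots,K$ let $p_k>0$ be real and $\bar n_k\ge 1$ an integer, with the users numbered so that $p_1/\bar n_1\ge p_2/\bar n_2\ge\dots\ge p_K/\bar n_K$. A multi-code CDMA system consists, for each user $k$, of a real $N\times\bar n_k$ signature-sequence matrix $S_k=[\underline s_{k,1},\dots,\underline s_{k,\bar n_k}]$ and a real positive semidefinite $\bar n_k\times\bar n_k$ data-correlation matrix $P_k$ with $\frac1N\mathrm{tr}(S_kP_kS_k^T)=p_k$. Its sum rate is $\frac1{2N}\log_2\det\bigl(I_N+\frac1{\sigma^2}\sum_{k=1}^K S_kP_kS_k^T\bigr)$, and it is sum-rate optimal if its sum rate is maximal among all such systems. We consider systems in the normalized form, i.e. each $P_k=\mathrm{diag}(p_{k,1},\dots,p_{k,\bar n_k})$ is diagonal and $\|\underline s_{k,l}\|^2=N$ for all $k,l$. A signature sequence $\underline s_{k,l}$ is active if $p_{k,l}>0$; it is an active orthogonal signature sequence if it is active and orthogonal to every other active signature sequence of the system, of the same or of another user. Let $n_k^{\perp}$ be the number of active orthogonal signature sequences of user $k$. Put $\hat n_k=\bigl(N-\sum_{k'=1}^{k-1}\bar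 n_{k'}\bigr)\,p_k/\sum_{k'=k}^{K}p_{k'}$. User $k$ is called undersized if $\hat n_k<\bar n_k$, and $K_2$ denotes the number of users that are not undersized. Then, for every $k$, the maximum of $n_k^{\perp}$ over all normalized sum-rate optimal systems exists and is $$\max n_k^{\perp}=\begin{cases}\bar n_k, & 1\le k\le K_2,\\[2mm] \left\lfloor\Bigl(N-\sum_{k'=1}^{K_2}\bar n_{k'}\Bigr)\dfrac{p_k}{\sum_{k'=K_2+1}^{K}p_{k'}}\right\rfloor, & K_2<k\le K.\end{cases}$$ Moreover, there is a normalized sum-rate optimal system that attains these maxima for all users $k$ simultaneously. -/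

import Mathlib

namespace MultiCodeCDMA

/-- A `K`-user multi-code CDMA system with processing gain `N`, in which user `k` has `n k` data
streams: for each user the signature-sequence matrix, whose column `l` is the signature sequence
of data stream `l`, and the data-correlation matrix `E[d dᵀ]` of the data-symbol vector `d`. -/
structure System (N K : ℕ) (n : Fin K → ℕ) where
  /-- The signature-sequence matrices. -/
  S : (k : Fin K) → Matrix (Fin N) (Fin (n k)) ℝ
  /-- The data-correlation matrices. -/
  P : (k : Fin K) → Matrix (Fin (n k)) (Fin (n k)) ℝ

namespace System

variable {N K : ℕ} {n : Fin K → ℕ}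

/-- The correlation matrix of the signal of user `k`. -/
def signalCov (c : System N K n) (k : Fin K) : Matrix (Fin N) (Fin N) ℝ :=
  c.S k * c.P k * (c.S k).transpose

/-- The system has legitimate correlation matrices and user `k` has average power `p k`. -/
def Feasible (c : System N K n) (p : Fin K → ℝ) : Prop :=
  ∀ k, (c.P k).PosSemidef ∧ (1 / (N : ℝ)) * (c.signalCov k).trace = p k

/-- The sum rate, in bits per chip, with Gaussian signalling and white Gaussian noise of variance
`σ ^ 2` per dimension. With `S = [S₁, …, S_K]` and `P = diag(P₁, …, P_K)`, the sum below is
`S * P * Sᵀ`. -/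
noncomputable def sumRate (c : System N K n) (σ : ℝ) : ℝ :=
  1 / (2 * (N : ℝ)) * Real.logb 2 (1 + (1 / σ ^ 2) • ∑ k, c.signalCov k).det

/-- The system attains the maximum sum rate among all feasible systems with the same numbers of
data streams (a stream may be switched off by giving it zero power). -/
def SumRateOptimal (c : System N K n) (p : Fin K → ℝ) (σ : ℝ) : Prop :=
  c.Feasible p ∧ ∀ c' : System N K n, c'.Feasible p → c'.sumRate σ ≤ c.sumRate σ

/-- The data streams of each user are uncorrelated and every signature sequence has squared norm
`N`. Then the diagonal entry `P k l l` is the power of data stream `l` of user `k`. -/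
def Normalized (c : System N K n) : Prop :=
  ∀ k, (c.P k).IsDiag ∧ ∀ l, ∑ i, c.S k i l ^ 2 = (N : ℝ)

/-- Data stream `j.2` of user `j.1` is active if it has positive power. -/
def Active (c : System N K n) (j : Σ k : Fin K, Fin (n k)) : Prop :=
  0 < c.P j.1 j.2 j.2

/-- The signature sequence `j` is active, and it is orthogonal to every other active signature
sequence in the system, of the same user or of another one. -/
def IsActiveOrthogonal (c : System N K n) (j : Σ k : Fin K, Fin (n k)) : Prop :=
  c.Active j ∧ ∀ j' : Σ k : Fin K, Fin (n k), j' ≠ j → c.Active j' →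
    ∑ i, c.S j.1 i j.2 * c.S j'.1 i j'.2 = 0

open Classical in
/-- The number of active orthogonal signature sequences of user `k`. -/
noncomputable def numOrthogonal (c : System N K n) (k : Fin K) : ℕ :=
  (Finset.univ.filter fun l : Fin (n k) => c.IsActiveOrthogonal ⟨k, l⟩).card

end System

/-- The due share of user `k` in the signal space: the part of the dimensions that is left after
serving the preceding users fully, in proportion to the powers of the users from `k` on. -/
noncomputable def dueShare (N : ℕ) {K : ℕ} (n : Fin K → ℕ) (p : Fin K → ℝ) (k : Fin K) : ℝ :=
  ((N : ℝ) - ∑ k' with k' < k, (n k' : ℝ)) * (p k / ∑ k' with k ≤ k', p k')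

/-- User `k` is undersized if its due share is less than its number of multi-codes. -/
def Undersized (N : ℕ) {K : ℕ} (n : Fin K → ℕ) (p : Fin K → ℝ) (k : Fin K) : Prop :=
  dueShare N n p k < (n k : ℝ)

open Classical in
/-- The number of non-undersized (that is, oversized or critically-sized) users. -/
noncomputable def numNonUndersized (N : ℕ) {K : ℕ} (n : Fin K → ℕ) (p : Fin K → ℝ) : ℕ :=
  (Finset.univ.filter fun k : Fin K => ¬ Undersized N n p k).card

/-- The claimed maximum number of active orthogonal signature sequences of user `k`. Users are
indexed from `0`, so the first `K₂` users are those with `(k : ℕ) < K₂`. -/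
noncomputable def maxOrthogonal (N : ℕ) {K : ℕ} (n : Fin K → ℕ) (p : Fin K → ℝ) (k : Fin K) : ℕ :=
  if (k : ℕ) < numNonUndersized N n p then n k
  else ⌊((N : ℝ) - ∑ k' with ((k' : Fin K) : ℕ) < numNonUndersized N n p, (n k' : ℝ)) *
    (p k / ∑ k' with numNonUndersized N n p ≤ ((k' : Fin K) : ℕ), p k')⌋₊

end MultiCodeCDMA

/-! Let `Z` be the covariance of the total signal. The sum rate depends only on the eigenvalues of
`Z`, through the sum of the concave terms `log (1 + x / σ ^ 2)`. Their total is `N` times the total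
power. The signal of the first `j` users has rank at most the number of their streams, so by Ky Fan
the corresponding number of largest eigenvalues carries at least `N` times the power of these users.
The flattest sequence meeting these constraints is `optimalEigenvalue`: each non-undersized user `k`
fills `n k` dimensions at the level `N * p k / n k`, and the undersized users share the remaining
dimensions at one common lowest level, `floorLevel`. Tangent lines and Abel summation show that this
sequence is best; strict concavity shows that every optimal `Z` has exactly these eigenvalues.

Upper bound: an active orthogonal sequence is an eigenvector of `Z` whose eigenvalue is `N` times
its power, hence at least `floorLevel`. The streams of user `k` have total power `p k`, so an
undersized user affords at most `N * p k / floorLevel` such sequences, which is its `dimShare`. For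
other users the bound `n k` is trivial.

Attainment: each user's `dimShare` is filled stream by stream, at most one dimension per stream. If
there are undersized users, the shares sum to `N`, and Schur-Horn gives a matrix with orthonormal
rows whose columns have these squared norms; a unit column is orthogonal to all others, so each full
share gives an orthogonal sequence. Otherwise distinct coordinate vectors suffice. -/

namespace MultiCodeCDMA

/-! ### Concave sums under majorization, and block sequences. -/

open Finset

/-- Abel summation: a monotone weighting of a sequence with total sum zero is nonpositive as soon as
the partial sums are nonnegative wherever the weight jumps. -/
theorem sum_mul_nonpos_of_partialSums_nonneg {N : ℕ} {w x : ℕ → ℝ} (hw : Monotone w)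
    (h0 : ∑ i ∈ range N, x i = 0)
    (hD : ∀ i, i + 1 < N → w i ≠ w (i + 1) → 0 ≤ ∑ m ∈ range (i + 1), x m) :
    ∑ i ∈ range N, w i * x i ≤ 0 := by
  have h := Finset.sum_range_by_parts w x N
  simp only [smul_eq_mul] at h
  rw [h, h0, mul_zero, zero_sub, neg_nonpos]
  refine sum_nonneg fun i hi => ?_
  by_cases he : w i = w (i + 1)
  · simp [he]
  · exact mul_nonneg (sub_nonneg.2 (hw (Nat.le_succ i)))
      (hD i (by have := mem_range.1 hi; omega) he)

theorem log_one_add_mul_le {s x t : ℝ} (hs : 0 < s) (hx : 0 ≤ x) (ht : 0 ≤ t) :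
    Real.log (1 + s * x) ≤ Real.log (1 + s * t) + s / (1 + s * t) * (x - t) := by
  have h1 : 0 < 1 + s * x := by positivity
  have h2 : 0 < 1 + s * t := by positivity
  have h := Real.log_le_sub_one_of_pos (div_pos h1 h2)
  rw [Real.log_div h1.ne' h2.ne'] at h
  have e : (1 + s * x) / (1 + s * t) - 1 = s / (1 + s * t) * (x - t) := by
    field_simp; ring
  linarith

theorem log_one_add_mul_lt {s x t : ℝ} (hs : 0 < s) (hx : 0 ≤ x) (ht : 0 ≤ t) (hxt : x ≠ t) :
    Real.log (1 + s * x) < Real.log (1 + s * t) + s / (1 + s * t) * (x - t) := by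
  have h1 : 0 < 1 + s * x := by positivity
  have h2 : 0 < 1 + s * t := by positivity
  have h := Real.log_lt_sub_one_of_pos (div_pos h1 h2) (by
    rw [Ne, div_eq_one_iff_eq h2.ne']
    intro h
    exact hxt (mul_left_cancel₀ hs.ne' (add_left_cancel h)))
  rw [Real.log_div h1.ne' h2.ne'] at h
  have e : (1 + s * x) / (1 + s * t) - 1 = s / (1 + s * t) * (x - t) := by
    field_simp; ring
  linarith

section Majorization

variable {N : ℕ} {s : ℝ} {x t : ℕ → ℝ}

/-- The slopes of the tangents at `t i` grow as `t` decreases and are constant where `t` is. Hence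
partial sums matter only at the jumps of `t`, and `x` need not be sorted. -/
theorem sum_tangent_nonpos (hs : 0 < s) (ht : ∀ i, 0 ≤ t i) (hanti : Antitone t)
    (hsum : ∑ i ∈ range N, x i = ∑ i ∈ range N, t i)
    (hD : ∀ i, i + 1 < N → t i ≠ t (i + 1) →
      ∑ m ∈ range (i + 1), t m ≤ ∑ m ∈ range (i + 1), x m) :
    ∑ i ∈ range N, s / (1 + s * t i) * (x i - t i) ≤ 0 := by
  refine sum_mul_nonpos_of_partialSums_nonneg (fun i j hij => ?_) (by simp [hsum])
    fun i hi hne => ?_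
  · have := hanti hij
    have h2 : 0 < 1 + s * t j := by have := ht j; positivity
    gcongr
  · rw [sum_sub_distrib, sub_nonneg]
    exact hD i hi fun h => hne (by rw [h])

theorem sum_log_le_of_majorizes (hs : 0 < s) (hx : ∀ i, 0 ≤ x i) (ht : ∀ i, 0 ≤ t i)
    (hanti : Antitone t)
    (hsum : ∑ i ∈ range N, x i = ∑ i ∈ range N, t i)
    (hD : ∀ i, i + 1 < N → t i ≠ t (i + 1) →
      ∑ m ∈ range (i + 1), t m ≤ ∑ m ∈ range (i + 1), x m) :
    ∑ i ∈ range N, Real.log (1 + s * x i) ≤ ∑ i ∈ range N, Real.log (1 + s * t i) := by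
  have h := sum_le_sum fun i (_ : i ∈ range N) => log_one_add_mul_le hs (hx i) (ht i)
  rw [sum_add_distrib] at h
  linarith [sum_tangent_nonpos hs ht hanti hsum hD]

/-- Strict concavity: a single term off its tangency point makes the summed tangent bound strict. -/
theorem eq_of_sum_log_eq_of_majorizes (hs : 0 < s) (hx : ∀ i, 0 ≤ x i) (ht : ∀ i, 0 ≤ t i)
    (hanti : Antitone t)
    (hsum : ∑ i ∈ range N, x i = ∑ i ∈ range N, t i)
    (hD : ∀ i, i + 1 < N → t i ≠ t (i + 1) →
      ∑ m ∈ range (i + 1), t m ≤ ∑ m ∈ range (i + 1), x m)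
    (heq : ∑ i ∈ range N, Real.log (1 + s * t i) ≤ ∑ i ∈ range N, Real.log (1 + s * x i))
    {i : ℕ} (hi : i < N) : x i = t i := by
  by_contra hne
  have h := sum_lt_sum (fun i (_ : i ∈ range N) => log_one_add_mul_le hs (hx i) (ht i))
    ⟨i, mem_range.2 hi, log_one_add_mul_lt hs (hx i) (ht i) hne⟩
  rw [sum_add_distrib] at h
  linarith [sum_tangent_nonpos hs ht hanti hsum hD]

end Majorization

/-- The number of the first `L` consecutive blocks, of lengths `m 0, m 1, …`, that end at or
before position `i`. -/
def blockIndex (m : ℕ → ℕ) (L i : ℕ) : ℕ :=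
  #{k ∈ range L | ∑ j ∈ range (k + 1), m j ≤ i}

section Block

variable {m : ℕ → ℕ} {L : ℕ}

theorem monotone_sum_range (m : ℕ → ℕ) : Monotone fun j => ∑ k ∈ range j, m k :=
  fun _ _ h => sum_le_sum_of_subset (range_subset_range.2 h)

theorem monotone_blockIndex : Monotone (blockIndex m L) := fun _ _ h =>
  card_le_card (monotone_filter_right _ fun _ _ hk => hk.trans h)

theorem blockIndex_eq {i j : ℕ} (hj : j < L) (h1 : ∑ k ∈ range j, m k ≤ i)
    (h2 : i < ∑ k ∈ range (j + 1), m k) : blockIndex m L i = j := by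
  have : {k ∈ range L | ∑ j ∈ range (k + 1), m j ≤ i} = range j := by
    ext k
    simp only [mem_filter, mem_range]
    constructor
    · rintro ⟨_, hk⟩
      by_contra hjk
      have := monotone_sum_range m (show j + 1 ≤ k + 1 by omega)
      simp only at this
      omega
    · intro hk
      exact ⟨hk.trans hj, (monotone_sum_range m (show k + 1 ≤ j by omega)).trans h1⟩
  rw [blockIndex, this, card_range]

theorem blockIndex_eq_of_le {i : ℕ} (h : ∑ k ∈ range L, m k ≤ i) : blockIndex m L i = L := by
  have : {k ∈ range L | ∑ j ∈ range (k + 1), m j ≤ i} = range L := by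
    refine filter_true_of_mem fun k hk => ?_
    exact (monotone_sum_range m (show k + 1 ≤ L from mem_range.1 hk)).trans h
  rw [blockIndex, this, card_range]

theorem exists_sum_eq_of_blockIndex_ne {i : ℕ}
    (h : blockIndex m L i ≠ blockIndex m L (i + 1)) :
    ∃ j ≤ L, ∑ k ∈ range j, m k = i + 1 := by
  by_contra! hne
  refine h (congrArg card (filter_congr fun k hk => ?_))
  have := hne (k + 1) (mem_range.1 hk)
  omega

theorem sum_range_blockIndex (g : ℕ → ℝ) {j : ℕ} (hj : j ≤ L) :
    ∑ i ∈ range (∑ k ∈ range j, m k), g (blockIndex m L i) = ∑ k ∈ range j, m k * g k := by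
  induction j with
  | zero => simp
  | succ j ih =>
    rw [sum_range_succ (fun k => (m k : ℝ) * g k), ← ih (by omega),
      ← sum_range_add_sum_Ico _ (monotone_sum_range m (Nat.le_succ j))]
    congr 1
    rw [sum_congr rfl (g := fun _ => g j) fun i hi => by
      rw [blockIndex_eq (show j < L by omega) (mem_Ico.1 hi).1 (mem_Ico.1 hi).2]]
    simp [sum_range_succ]

theorem sum_range_blockIndex_total (g : ℕ → ℝ) {N : ℕ} (hN : ∑ k ∈ range L, m k ≤ N) :
    ∑ i ∈ range N, g (blockIndex m L i) =
      ∑ k ∈ range L, m k * g k + ((N : ℝ) - ∑ k ∈ range L, (m k : ℝ)) * g L := by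
  rw [← sum_range_add_sum_Ico _ hN, sum_range_blockIndex g le_rfl,
    sum_congr rfl (s₁ := Ico _ _) (g := fun _ => g L) fun i hi => by
      rw [blockIndex_eq_of_le (mem_Ico.1 hi).1]]
  simp [Nat.cast_sub hN]

end Block

end MultiCodeCDMA

/-! ### Sorted eigenvalues and Ky Fan's inequality. -/

namespace MultiCodeCDMA

open Finset Matrix

section Spectral

variable {m : Type*} [Fintype m] [DecidableEq m] {Z : Matrix m m ℝ}

theorem star_eigenvectorUnitary_mul_mul (hZ : Z.IsHermitian) :
    star (hZ.eigenvectorUnitary : Matrix m m ℝ) * Z * (hZ.eigenvectorUnitary : Matrix m m ℝ) =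
      diagonal hZ.eigenvalues := by
  have h := hZ.conjStarAlgAut_star_eigenvectorUnitary
  rw [Unitary.conjStarAlgAut_star_apply] at h
  exact h

theorem det_one_add_smul_eq_prod (hZ : Z.IsHermitian) (s : ℝ) :
    (1 + s • Z).det = ∏ i, (1 + s * hZ.eigenvalues i) := by
  set U : Matrix m m ℝ := (hZ.eigenvectorUnitary : Matrix m m ℝ) with hU
  have hUU : star U * U = 1 := Unitary.coe_star_mul_self hZ.eigenvectorUnitary
  have h1 : star U * (1 + s • Z) * U = diagonal fun i => 1 + s * hZ.eigenvalues i := by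
    rw [mul_add, add_mul, mul_one, hUU, mul_smul_comm, smul_mul_assoc,
      star_eigenvectorUnitary_mul_mul, ← diagonal_one, ← diagonal_smul, diagonal_add]
    rfl
  have h2 := congrArg det h1
  rw [det_diagonal, det_mul_right_comm, hUU, one_mul] at h2
  exact h2

theorem eigenvalue_of_mulVec_eq (hZ : Z.IsHermitian) {v : m → ℝ} (hv : v ≠ 0) {x : ℝ}
    (h : Z *ᵥ v = x • v) : ∃ i, hZ.eigenvalues i = x := by
  have hx : x ∈ spectrum ℝ Z := by
    rw [← spectrum_toLin']
    exact (Module.End.hasEigenvalue_of_hasEigenvector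
      (Module.End.hasEigenvector_iff.2 ⟨Module.End.mem_eigenspace_iff.2 (by simpa using h),
        hv⟩)).mem_spectrum
  rw [hZ.spectrum_real_eq_range_eigenvalues] at hx
  exact hx

end Spectral

section Sorted

variable {N : ℕ} {Z : Matrix (Fin N) (Fin N) ℝ}

/-- The eigenvalues of a Hermitian matrix in decreasing order, followed by zeros. -/
noncomputable def sortedEigenvalues (hZ : Z.IsHermitian) (i : ℕ) : ℝ :=
  if h : i < N then hZ.eigenvalues₀ ⟨i, by simpa using h⟩ else 0

/-- The position of an eigenvalue in the decreasing order. -/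
noncomputable def eigenvalueRank (N : ℕ) : Fin N ≃ Fin N :=
  (Fintype.equivOfCardEq (Fintype.card_fin (Fintype.card (Fin N)))).symm.trans
    (finCongr (Fintype.card_fin N))

theorem sortedEigenvalues_eigenvalueRank (hZ : Z.IsHermitian) (i : Fin N) :
    sortedEigenvalues hZ (eigenvalueRank N i) = hZ.eigenvalues i := by
  rw [sortedEigenvalues, dif_pos (Fin.is_lt _)]
  -- `eigenvalues` is by definition `eigenvalues₀` reindexed by the equivalence inside
  -- `eigenvalueRank`.
  rfl

theorem sum_range_eq_sum_eigenvalueRank (f : ℕ → ℝ) :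
    ∑ i ∈ range N, f i = ∑ i, f (eigenvalueRank N i) := by
  rw [(eigenvalueRank N).sum_comp (fun i => f i), Fin.sum_univ_eq_sum_range]

theorem sum_range_sortedEigenvalues (hZ : Z.IsHermitian) (g : ℝ → ℝ) :
    ∑ i ∈ range N, g (sortedEigenvalues hZ i) = ∑ i, g (hZ.eigenvalues i) := by
  rw [sum_range_eq_sum_eigenvalueRank (fun i => g (sortedEigenvalues hZ i))]
  simp only [sortedEigenvalues_eigenvalueRank]

theorem sortedEigenvalues_nonneg (hZ : Z.PosSemidef) (i : ℕ) :
    0 ≤ sortedEigenvalues hZ.1 i := by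
  by_cases h : i < N
  · have := sortedEigenvalues_eigenvalueRank hZ.1 ((eigenvalueRank N).symm ⟨i, h⟩)
    rw [Equiv.apply_symm_apply] at this
    rw [this]
    exact hZ.eigenvalues_nonneg _
  · rw [sortedEigenvalues, dif_neg h]

theorem antitone_sortedEigenvalues (hZ : Z.PosSemidef) : Antitone (sortedEigenvalues hZ.1) := by
  intro i j hij
  by_cases h : j < N
  · rw [sortedEigenvalues, sortedEigenvalues, dif_pos h, dif_pos (hij.trans_lt h)]
    exact hZ.1.eigenvalues₀_antitone hij
  · rw [sortedEigenvalues, dif_neg h]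
    exact sortedEigenvalues_nonneg hZ i

theorem sum_range_sortedEigenvalues_eq_trace (hZ : Z.IsHermitian) :
    ∑ i ∈ range N, sortedEigenvalues hZ i = Z.trace := by
  rw [hZ.trace_eq_sum_eigenvalues]
  exact sum_range_sortedEigenvalues hZ id

theorem log_det_one_add_smul (hZ : Z.PosSemidef) {s : ℝ} (hs : 0 < s) :
    Real.log (1 + s • Z).det = ∑ i ∈ range N, Real.log (1 + s * sortedEigenvalues hZ.1 i) := by
  rw [det_one_add_smul_eq_prod hZ.1, Real.log_prod fun i _ => ?_,
    sum_range_sortedEigenvalues hZ.1 fun x => Real.log (1 + s * x)]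
  have := hZ.eigenvalues_nonneg i
  positivity

theorem det_one_add_smul_pos (hZ : Z.PosSemidef) {s : ℝ} (hs : 0 < s) :
    0 < (1 + s • Z).det := by
  rw [det_one_add_smul_eq_prod hZ.1]
  refine prod_pos fun i _ => ?_
  have := hZ.eigenvalues_nonneg i
  positivity

/-- A weighted sum of a nonnegative decreasing sequence, with weights in `[0, 1]` of total at most
`M`, is at most the sum of the first `M` terms. -/
theorem sum_mul_le_sum_range {x : ℕ → ℝ} (h0 : ∀ i, 0 ≤ x i) (hx : Antitone x) {c : Fin N → ℝ}
    (hc0 : ∀ i, 0 ≤ c i) (hc1 : ∀ i, c i ≤ 1) {M : ℕ} (hM : M ≤ N) (hcM : ∑ i, c i ≤ M)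
    (e : Fin N ≃ Fin N) : ∑ i, x (e i) * c i ≤ ∑ i ∈ range M, x i := by
  -- After subtracting the threshold `x M`, weights in `[0, 1]` gain at most the positive part,
  -- which lives on the first `M` indices.
  have h1 : ∀ i ∈ univ, x (e i) * c i ≤
      x M * c i + (fun j : Fin N => if (j : ℕ) < M then x j - x M else 0) (e i) := by
    intro i _
    simp only
    split_ifs with h
    · nlinarith [hx h.le, hc1 i]
    · nlinarith [hx (not_lt.1 h), hc0 i]
  refine (sum_le_sum h1).trans ?_
  rw [sum_add_distrib, ← mul_sum, e.sum_comp (fun j : Fin N => if (j : ℕ) < M then x j - x M else 0),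
    Fin.sum_univ_eq_sum_range (fun j => if j < M then x j - x M else 0), ← sum_filter]
  have : {j ∈ range N | j < M} = range M := by ext j; simp; omega
  rw [this, sum_sub_distrib]
  simp only [sum_const, card_range, nsmul_eq_mul]
  nlinarith [h0 M]

/-- **Ky Fan**: the sum of the `M` largest eigenvalues of `B + C` is at least the trace of `B` if
`B` has rank at most `M`. -/
theorem trace_le_sum_sortedEigenvalues {B C : Matrix (Fin N) (Fin N) ℝ} (hB : B.PosSemidef)
    (hC : C.PosSemidef) (hZ : (B + C).PosSemidef) {M : ℕ} (hM : M ≤ N) (hr : B.rank ≤ M) :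
    B.trace ≤ ∑ i ∈ range M, sortedEigenvalues hZ.1 i := by
  set W : Matrix (Fin N) (Fin N) ℝ := (hB.1.eigenvectorUnitary : Matrix (Fin N) (Fin N) ℝ)
  set U : Matrix (Fin N) (Fin N) ℝ := (hZ.1.eigenvectorUnitary : Matrix (Fin N) (Fin N) ℝ)
  have hWW : W * star W = 1 := Unitary.coe_mul_star_self hB.1.eigenvectorUnitary
  have hWW' : star W * W = 1 := Unitary.coe_star_mul_self hB.1.eigenvectorUnitary
  have hUU : U * star U = 1 := Unitary.coe_mul_star_self hZ.1.eigenvectorUnitary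
  have hUU' : star U * U = 1 := Unitary.coe_star_mul_self hZ.1.eigenvectorUnitary
  have hdU : star U * (B + C) * U = diagonal hZ.1.eigenvalues :=
    star_eigenvectorUnitary_mul_mul hZ.1
  have hdW : star W * B * W = diagonal hB.1.eigenvalues := star_eigenvectorUnitary_mul_mul hB.1
  -- The change of basis between the two eigenbases. The squares of its entries are doubly
  -- stochastic, and each eigenvalue of `B` is at most the corresponding average of those of `B +
  -- C`.
  set O := star U * W with hO
  have hsO : star O = star W * U := by simp [hO]
  have hOO : O * star O = 1 := by
    rw [hsO, hO, mul_assoc, ← mul_assoc W, hWW, one_mul, hUU']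
  have hOO' : star O * O = 1 := by
    rw [hsO, hO, mul_assoc, ← mul_assoc U, hUU, one_mul, hWW']
  have hOd : star O * diagonal hZ.1.eigenvalues * O = star W * (B + C) * W := by
    rw [← hdU, hsO, hO]
    calc star W * U * (star U * (B + C) * U) * (star U * W)
        = star W * (U * star U) * (B + C) * (U * star U) * W := by simp only [mul_assoc]
      _ = _ := by rw [hUU, mul_one, mul_one]
  have hrow : ∀ i, ∑ k, O i k ^ 2 = 1 := fun i => by
    have := congrFun (congrFun hOO i) i
    simpa [mul_apply, sq, star_eq_conjTranspose] using this
  have hcol : ∀ k, ∑ i, O i k ^ 2 = 1 := fun k => by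
    have := congrFun (congrFun hOO' k) k
    simpa [mul_apply, sq, star_eq_conjTranspose] using this
  have hle : ∀ k, hB.1.eigenvalues k ≤ ∑ i, hZ.1.eigenvalues i * O i k ^ 2 := fun k => by
    have h1 : (star W * (B + C) * W) k k = ∑ i, hZ.1.eigenvalues i * O i k ^ 2 := by
      rw [← hOd, mul_apply]
      simp only [mul_diagonal, star_eq_conjTranspose, conjTranspose_apply, star_trivial]
      exact sum_congr rfl fun i _ => by ring
    have h2 : (star W * (B + C) * W) k k = hB.1.eigenvalues k + (star W * C * W) k k := by
      rw [mul_add, add_mul, hdW, Matrix.add_apply, diagonal_apply_eq]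
    have h3 : 0 ≤ (star W * C * W) k k := (hC.conjTranspose_mul_mul_same W).diag_nonneg
    linarith
  -- Only the nonzero eigenvalues of `B` contribute, and the rank counts them; this bounds the total
  -- weight by `M`.
  set I : Finset (Fin N) := {k | hB.1.eigenvalues k ≠ 0} with hI
  have hIcard : I.card ≤ M := by
    rw [hB.1.rank_eq_card_non_zero_eigs, Fintype.card_subtype] at hr
    exact hr
  calc B.trace = ∑ k, hB.1.eigenvalues k := hB.1.trace_eq_sum_eigenvalues
    _ = ∑ k ∈ I, hB.1.eigenvalues k := by rw [hI, sum_filter_ne_zero]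
    _ ≤ ∑ k ∈ I, ∑ i, hZ.1.eigenvalues i * O i k ^ 2 := sum_le_sum fun k _ => hle k
    _ = ∑ i, sortedEigenvalues hZ.1 (eigenvalueRank N i) * ∑ k ∈ I, O i k ^ 2 := by
      rw [sum_comm]
      simp only [mul_sum, sortedEigenvalues_eigenvalueRank]
    _ ≤ _ := by
      refine sum_mul_le_sum_range (sortedEigenvalues_nonneg hZ) (antitone_sortedEigenvalues hZ)
        (fun i => sum_nonneg fun k _ => sq_nonneg _) (fun i => ?_) hM ?_ _
      · rw [← hrow i]
        exact sum_le_sum_of_subset_of_nonneg (subset_univ _) fun k _ _ => sq_nonneg _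
      · rw [sum_comm]
        simp only [hcol, sum_const, nsmul_eq_mul, mul_one]
        exact_mod_cast hIcard

end Sorted

end MultiCodeCDMA

/-! ### Matrices with orthonormal rows and prescribed column norms. -/

namespace MultiCodeCDMA

open Finset Matrix

section Rotation

variable {m ι : Type*} [DecidableEq ι]

/-- The columns `i` and `j` of a matrix are rotated by the angle `θ` in their plane. -/
noncomputable def rotateColumns (V : Matrix m ι ℝ) (i j : ι) (θ : ℝ) : Matrix m ι ℝ :=
  fun r k => if k = i then Real.cos θ * V r i + Real.sin θ * V r j
    else if k = j then Real.cos θ * V r j - Real.sin θ * V r i else V r k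

variable (V : Matrix m ι ℝ) {i j : ι} (θ : ℝ)

theorem rotateColumns_left (r : m) :
    rotateColumns V i j θ r i = Real.cos θ * V r i + Real.sin θ * V r j := by
  simp [rotateColumns]

theorem rotateColumns_right (hij : i ≠ j) (r : m) :
    rotateColumns V i j θ r j = Real.cos θ * V r j - Real.sin θ * V r i := by
  simp [rotateColumns, hij.symm]

theorem rotateColumns_of_ne {k : ι} (hi : k ≠ i) (hj : k ≠ j) (r : m) :
    rotateColumns V i j θ r k = V r k := by
  simp [rotateColumns, hi, hj]

theorem sum_eq_add_add_sum_erase [Fintype ι] (hij : i ≠ j) (f : ι → ℝ) :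
    ∑ k, f k = f i + f j + ∑ k ∈ (univ.erase i).erase j, f k := by
  rw [← add_sum_erase univ f (mem_univ i),
    ← add_sum_erase (univ.erase i) f (mem_erase.2 ⟨hij.symm, mem_univ j⟩), add_assoc]

theorem rotateColumns_mul_transpose [Fintype ι] (hij : i ≠ j) :
    rotateColumns V i j θ * (rotateColumns V i j θ)ᵀ = V * Vᵀ := by
  ext r r'
  simp only [mul_apply, transpose_apply]
  rw [sum_eq_add_add_sum_erase hij, sum_eq_add_add_sum_erase hij (fun k => V r k * V r' k)]
  congr 1
  · simp only [rotateColumns_left, rotateColumns_right V θ hij]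
    linear_combination (V r i * V r' i + V r j * V r' j) * Real.cos_sq_add_sin_sq θ
  · refine sum_congr rfl fun k hk => ?_
    simp only [mem_erase, mem_univ, and_true] at hk
    rw [rotateColumns_of_ne V θ hk.2 hk.1, rotateColumns_of_ne V θ hk.2 hk.1]

/-- Rotating two columns moves the squared norm of the first to any value between the squared norms
of both, while the sum of the squared norms stays the same. -/
theorem exists_rotateColumns_sq_norm [Fintype m] (hij : i ≠ j) {y : ℝ}
    (h1 : ∑ r, V r i ^ 2 ≤ y) (h2 : y ≤ ∑ r, V r j ^ 2) :
    ∃ θ, ∑ r, rotateColumns V i j θ r i ^ 2 = y ∧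
      ∑ r, rotateColumns V i j θ r j ^ 2 = ∑ r, V r i ^ 2 + ∑ r, V r j ^ 2 - y := by
  have hc : Continuous fun θ => ∑ r, rotateColumns V i j θ r i ^ 2 := by
    simp only [rotateColumns_left]
    fun_prop
  -- The rotated column is column `i` at angle `0` and column `j` at angle `π / 2`.
  obtain ⟨θ, _, hθ⟩ := intermediate_value_Icc (a := (0 : ℝ)) (b := Real.pi / 2) (by positivity)
    hc.continuousOn (show y ∈ Set.Icc _ _ by
      simp only [rotateColumns_left]
      simpa using ⟨h1, h2⟩)
  refine ⟨θ, hθ, ?_⟩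
  rw [← hθ, eq_sub_iff_add_eq, ← sum_add_distrib, ← sum_add_distrib]
  refine sum_congr rfl fun r _ => ?_
  rw [rotateColumns_left, rotateColumns_right V θ hij]
  linear_combination (V r i ^ 2 + V r j ^ 2) * Real.cos_sq_add_sin_sq θ

end Rotation

/-- A special case of the **Schur-Horn theorem**: a sequence in `[0, 1]` whose sum is the integer
`N` consists of the squared norms of the columns of an `N`-rowed matrix with orthonormal rows. -/
theorem exists_mul_transpose_eq_one_of_sum_eq {N : ℕ} {ι : Type*} [Fintype ι] [DecidableEq ι]
    (a : ι → ℝ) (h0 : ∀ j, 0 ≤ a j) (h1 : ∀ j, a j ≤ 1) (hsum : ∑ j, a j = N) :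
    ∃ V : Matrix (Fin N) ι ℝ, V * Vᵀ = 1 ∧ ∀ j, ∑ r, V r j ^ 2 = a j := by
  classical
  -- Induction on the number of fractional entries.
  induction hd : #{j | a j ≠ 0 ∧ a j ≠ 1} using Nat.strong_induction_on generalizing a with
  | _ d ih =>
  subst hd
  by_cases hfrac : ∃ i, a i ≠ 0 ∧ a i ≠ 1
  · obtain ⟨i, hi0, hi1⟩ := hfrac
    -- Since the total is an integer, a fractional entry cannot be the only one.
    have hother : ∃ j, j ≠ i ∧ a j ≠ 0 ∧ a j ≠ 1 := by
      by_contra! hno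
      have hsplit := add_sum_erase univ a (mem_univ i)
      have : ∑ k ∈ univ.erase i, a k = #{k ∈ univ.erase i | a k ≠ 0} := by
        rw [card_eq_sum_ones, Nat.cast_sum, sum_filter]
        refine sum_congr rfl fun k hk => ?_
        by_cases hk0 : a k = 0
        · simp [hk0]
        · simp [hno k (ne_of_mem_erase hk) hk0]
      rw [this, hsum] at hsplit
      have hlo : 0 < a i := lt_of_le_of_ne (h0 i) hi0.symm
      have hhi : a i < 1 := lt_of_le_of_ne (h1 i) hi1
      have e : a i = ((N : ℤ) - (#{k ∈ univ.erase i | a k ≠ 0} : ℤ) : ℤ) := by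
        push_cast; linarith
      rw [e] at hlo hhi
      have h2 : (0 : ℤ) < (N : ℤ) - (#{k ∈ univ.erase i | a k ≠ 0} : ℤ) := by exact_mod_cast hlo
      have h3 : (N : ℤ) - (#{k ∈ univ.erase i | a k ≠ 0} : ℤ) < 1 := by exact_mod_cast hhi
      omega
    obtain ⟨i, j, hij, hle, hi0, hi1, hj0, hj1⟩ : ∃ i j, i ≠ j ∧ a i ≤ a j ∧ a i ≠ 0 ∧ a i ≠ 1 ∧
        a j ≠ 0 ∧ a j ≠ 1 := by
      obtain ⟨j, hji, hj0, hj1⟩ := hother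
      rcases le_total (a i) (a j) with h | h
      · exact ⟨i, j, hji.symm, h, hi0, hi1, hj0, hj1⟩
      · exact ⟨j, i, hji, h, hj0, hj1, hi0, hi1⟩
    -- Mass moves from the smaller entry to the larger until one of them reaches `0` or `1`. The new
    -- pair encloses the old one, so a rotation of the two columns undoes the move.
    set δ := min (a i) (1 - a j) with hδ
    have hδ0 : 0 ≤ δ := le_min (h0 i) (by linarith [h1 j])
    have hδi : δ ≤ a i := min_le_left _ _
    have hδj : δ ≤ 1 - a j := min_le_right _ _
    set b : ι → ℝ := fun k => if k = i then a i - δ else if k = j then a j + δ else a k with hb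
    have hbi : b i = a i - δ := by simp [hb]
    have hbj : b j = a j + δ := by simp [hb, hij.symm]
    have hbk : ∀ k, k ≠ i → k ≠ j → b k = a k := fun k hki hkj => by simp [hb, hki, hkj]
    have hbounds : ∀ k, 0 ≤ b k ∧ b k ≤ 1 := by
      intro k
      by_cases hki : k = i
      · rw [hki, hbi]; constructor <;> linarith [h1 i]
      by_cases hkj : k = j
      · rw [hkj, hbj]; constructor <;> linarith [h0 j]
      · rw [hbk k hki hkj]; exact ⟨h0 k, h1 k⟩
    have hbsum : ∑ k, b k = N := by
      rw [← hsum, sum_eq_add_add_sum_erase hij, sum_eq_add_add_sum_erase hij a, hbi, hbj]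
      congr 1
      · ring
      · refine sum_congr rfl fun k hk => ?_
        simp only [mem_erase, mem_univ, and_true] at hk
        exact hbk k hk.2 hk.1
    have hlt : #{k | b k ≠ 0 ∧ b k ≠ 1} < #{k | a k ≠ 0 ∧ a k ≠ 1} := by
      refine card_lt_card (Finset.ssubset_iff_subset_ne.2 ⟨fun k hk => ?_, fun he => ?_⟩)
      · simp only [mem_filter, mem_univ, true_and] at hk ⊢
        by_cases hki : k = i
        · rw [hki]; exact ⟨hi0, hi1⟩
        by_cases hkj : k = j
        · rw [hkj]; exact ⟨hj0, hj1⟩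
        · rwa [hbk k hki hkj] at hk
      · rcases min_choice (a i) (1 - a j) with h | h
        · have : i ∈ ({k | a k ≠ 0 ∧ a k ≠ 1} : Finset ι) := by simp [hi0, hi1]
          rw [← he, mem_filter, hbi, hδ, h, sub_self] at this
          exact this.2.1 rfl
        · have : j ∈ ({k | a k ≠ 0 ∧ a k ≠ 1} : Finset ι) := by simp [hj0, hj1]
          rw [← he, mem_filter, hbj, hδ, h, add_sub_cancel] at this
          exact this.2.2 rfl
    obtain ⟨V, hV, hVb⟩ := ih _ hlt b (fun k => (hbounds k).1) (fun k => (hbounds k).2) hbsum rfl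
    obtain ⟨θ, hθi, hθj⟩ := exists_rotateColumns_sq_norm V hij (y := a i)
      (by rw [hVb, hbi]; linarith) (by rw [hVb, hbj]; linarith)
    refine ⟨rotateColumns V i j θ, by rw [rotateColumns_mul_transpose V θ hij, hV], fun k => ?_⟩
    by_cases hki : k = i
    · rw [hki, hθi]
    by_cases hkj : k = j
    · rw [hkj, hθj, hVb, hVb, hbi, hbj]; ring
    · simp only [rotateColumns_of_ne V θ hki hkj]
      rw [hVb, hbk k hki hkj]
  -- With all entries `0` or `1` there are exactly `N` ones: their columns are the standard basis
  -- vectors, the others vanish.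
  · push Not at hfrac
    have hcard : Fintype.card (Fin N) = Fintype.card {j // a j = 1} := by
      rw [Fintype.card_fin, Fintype.card_subtype]
      rw [← Nat.cast_inj (R := ℝ), ← hsum, card_eq_sum_ones, Nat.cast_sum, sum_filter]
      refine sum_congr rfl fun k _ => ?_
      by_cases hk : a k = 0
      · simp [hk]
      · simp [hfrac k hk]
    let e := Fintype.equivOfCardEq hcard
    refine ⟨of fun r k => if (e r : ι) = k then 1 else 0, ?_, fun k => ?_⟩
    · ext r r'
      simp [mul_apply, one_apply, Subtype.coe_inj]
    · by_cases hk : a k = 1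
      · rw [sum_eq_single (e.symm ⟨k, hk⟩)]
        · simp [hk]
        · intro r _ hr
          rw [of_apply, if_neg fun h => hr ?_]
          · simp
          · rw [e.eq_symm_apply]; exact Subtype.ext h
        · simp
      · have hk0 : a k = 0 := by
          by_contra h
          exact hk (hfrac k h)
        rw [hk0]
        refine sum_eq_zero fun r _ => ?_
        rw [of_apply, if_neg fun h => hk ?_]
        · simp
        · rw [← h]; exact (e r).2

/-- A column of norm one of a matrix with orthonormal rows is orthogonal to all other columns. -/
theorem sum_mul_eq_zero_of_sq_norm_eq_one {m ι : Type*} [Fintype m] [DecidableEq m] [Fintype ι]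
    {V : Matrix m ι ℝ} (hV : V * Vᵀ = 1) {j k : ι} (hj : ∑ r, V r j ^ 2 = 1) (hjk : k ≠ j) :
    ∑ r, V r j * V r k = 0 := by
  classical
  -- The Gram matrix is idempotent, so its entry `(j, j)` is the sum of squares of row `j`; if that
  -- entry is one, the rest of the row is zero.
  have h : (Vᵀ * V) * (Vᵀ * V) = Vᵀ * V := by
    rw [Matrix.mul_assoc, ← Matrix.mul_assoc V, hV, Matrix.one_mul]
  have hjj := congrFun (congrFun h j) j
  have hG : ∀ x y, (Vᵀ * V) x y = ∑ r, V r x * V r y := fun x y => by simp [mul_apply]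
  rw [mul_apply, ← add_sum_erase _ _ (mem_univ j)] at hjj
  have h1 : (Vᵀ * V) j j = 1 := by rw [hG, ← hj]; simp [sq]
  have hs : ∀ x, (Vᵀ * V) x j = (Vᵀ * V) j x := fun x => by simp only [hG, mul_comm]
  simp only [h1, hs, ← sq, one_pow] at hjj
  have := (sum_eq_zero_iff_of_nonneg (fun x _ => sq_nonneg ((Vᵀ * V) j x))).1
    (add_eq_left.1 hjj) k (mem_erase.2 ⟨hjk, mem_univ k⟩)
  rw [← hG]
  exact pow_eq_zero_iff two_ne_zero |>.1 this

end MultiCodeCDMA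

/-! ### Undersized users and the dimensions left to them. -/

namespace MultiCodeCDMA

open Finset Matrix

section Users

variable {N K : ℕ} (n : Fin K → ℕ) (p : Fin K → ℝ)

/-- The total number of data streams of the first `j` users. -/
def servedStreams (j : ℕ) : ℕ := ∑ k with ((k : Fin K) : ℕ) < j, n k

/-- The total power of the first `j` users. -/
def powerBefore (j : ℕ) : ℝ := ∑ k with ((k : Fin K) : ℕ) < j, p k

/-- The total power of the users from `j` on. -/
def powerFrom (j : ℕ) : ℝ := ∑ k with j ≤ ((k : Fin K) : ℕ), p k

theorem sum_filter_lt_succ {α : Type*} [AddCommMonoid α] (f : Fin K → α) (k : Fin K) :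
    ∑ i with ((i : Fin K) : ℕ) < k + 1, f i = ∑ i with ((i : Fin K) : ℕ) < k, f i + f k := by
  have : ({i | (i : ℕ) < k + 1} : Finset (Fin K)) =
      insert k ({i | (i : ℕ) < k} : Finset (Fin K)) := by
    ext i
    simp only [mem_filter, mem_univ, true_and, mem_insert, Fin.ext_iff]
    omega
  rw [this, sum_insert (by simp), add_comm]

theorem sum_filter_lt_eq_sum_range {α : Type*} [AddCommMonoid α] (f : Fin K → α) {g : ℕ → α}
    (hg : ∀ k : Fin K, g k = f k) {j : ℕ} (hj : j ≤ K) :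
    ∑ i with ((i : Fin K) : ℕ) < j, f i = ∑ i ∈ range j, g i := by
  induction j with
  | zero => simp
  | succ j ih =>
    rw [sum_filter_lt_succ f ⟨j, hj⟩, sum_range_succ, ih (by omega), hg ⟨j, hj⟩]

theorem servedStreams_succ (k : Fin K) :
    servedStreams n (k + 1) = servedStreams n k + n k := sum_filter_lt_succ n k

theorem powerBefore_add_powerFrom (j : ℕ) : powerBefore p j + powerFrom p j = ∑ k, p k := by
  simp only [powerBefore, powerFrom, ← not_lt]
  exact sum_filter_add_sum_filter_not _ _ _

theorem powerFrom_eq (k : Fin K) : powerFrom p k = p k + powerFrom p (k + 1) := by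
  have h1 := powerBefore_add_powerFrom p k
  have h2 := powerBefore_add_powerFrom p (k + 1)
  have h3 : powerBefore p (k + 1) = powerBefore p k + p k := sum_filter_lt_succ p k
  linarith

theorem powerFrom_nonneg (hp : ∀ k, 0 < p k) (j : ℕ) : 0 ≤ powerFrom p j :=
  sum_nonneg fun k _ => (hp k).le

theorem powerFrom_pos (hp : ∀ k, 0 < p k) {j : ℕ} (hj : j < K) : 0 < powerFrom p j :=
  sum_pos (fun k _ => hp k) ⟨⟨j, hj⟩, by simp⟩

theorem powerFrom_of_le {j : ℕ} (hj : K ≤ j) : powerFrom p j = 0 := by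
  refine sum_eq_zero fun k hk => ?_
  have := (mem_filter.1 hk).2
  omega

variable {n p} (hn : ∀ k, 1 ≤ n k) (hp : ∀ k, 0 < p k)
  (hord : ∀ k k' : Fin K, k ≤ k' → p k' / (n k' : ℝ) ≤ p k / (n k : ℝ))

include hp in
theorem undersized_iff_mul_lt (k : Fin K) : Undersized N n p k ↔
    ((N : ℝ) - servedStreams n k) * p k < n k * powerFrom p k := by
  have hpos := powerFrom_pos p hp k.2
  have : dueShare N n p k = ((N : ℝ) - servedStreams n k) * p k / powerFrom p k := by
    rw [mul_div_assoc, servedStreams, Nat.cast_sum]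
    rfl
  rw [Undersized, this, div_lt_iff₀ hpos]

include hn hp hord

/-- Being undersized says that the dimensions left after user `k`, relative to the power left, are
fewer than `n k / p k`, which is at most `n k' / p k'`. -/
theorem undersized_of_succ {k k' : Fin K} (hk : (k' : ℕ) = k + 1) (h : Undersized N n p k) :
    Undersized N n p k' := by
  rw [undersized_iff_mul_lt hp] at h ⊢
  have hnk : (0 : ℝ) < n k := by exact_mod_cast hn k
  have hnk' : (0 : ℝ) < n k' := by exact_mod_cast hn k'
  have ho := hord k k' (by rw [Fin.le_def]; omega)
  rw [div_le_div_iff₀ hnk' hnk] at ho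
  have hpos := powerFrom_pos p hp k'.2
  rw [hk] at hpos ⊢
  rw [servedStreams_succ, Nat.cast_add]
  rw [powerFrom_eq] at h
  -- If no dimension is left, the due share of `k'` is nonpositive; the ordering is needed only
  -- otherwise.
  rcases le_or_gt ((N : ℝ) - (servedStreams n k + n k)) 0 with hle | hgt
  · have := hp k'
    have : 0 < n k' * powerFrom p (k + 1) := by positivity
    nlinarith
  · rw [← mul_lt_mul_iff_right₀ hnk]
    calc (n k : ℝ) * (((N : ℝ) - (servedStreams n k + n k)) * p k')
        = ((N : ℝ) - (servedStreams n k + n k)) * (p k' * n k) := by ring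
      _ ≤ ((N : ℝ) - (servedStreams n k + n k)) * (p k * n k') :=
          mul_le_mul_of_nonneg_left ho hgt.le
      _ = n k' * (((N : ℝ) - (servedStreams n k + n k)) * p k) := by ring
      _ < n k' * (n k * powerFrom p (k + 1)) := mul_lt_mul_of_pos_left (by linarith) hnk'
      _ = _ := by ring

theorem undersized_of_le {k k' : Fin K} (hk : k ≤ k') (h : Undersized N n p k) :
    Undersized N n p k' := by
  obtain ⟨j, hj⟩ := k'
  rw [Fin.le_def] at hk
  simp only at hk
  induction j, hk using Nat.le_induction with
  | base => exact h
  | succ j hkj ih => exact undersized_of_succ hn hp hord (k := ⟨j, by omega⟩) rfl (ih (by omega))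

/-- The non-undersized users are the first ones. -/
theorem not_undersized_iff (k : Fin K) :
    ¬ Undersized N n p k ↔ (k : ℕ) < numNonUndersized N n p := by
  classical
  have hcard : numNonUndersized N n p = #{k : Fin K | ¬ Undersized N n p k} := by
    rw [numNonUndersized]
  constructor
  · intro h
    have hsub : Iic k ⊆ ({k : Fin K | ¬ Undersized N n p k} : Finset (Fin K)) := fun i hi => by
      simp only [mem_filter, mem_univ, true_and]
      exact fun hi' => h (undersized_of_le hn hp hord (mem_Iic.1 hi) hi')
    have := card_le_card hsub
    rw [Fin.card_Iic] at this
    omega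
  · intro h hu
    have hsub : ({k : Fin K | ¬ Undersized N n p k} : Finset (Fin K)) ⊆ Iio k := fun i hi => by
      simp only [mem_filter, mem_univ, true_and] at hi
      rw [mem_Iio]
      by_contra hle
      exact hi (undersized_of_le hn hp hord (not_lt.1 hle) hu)
    have := card_le_card hsub
    rw [Fin.card_Iio] at this
    omega

omit hn hp hord in
theorem numNonUndersized_le : numNonUndersized N n p ≤ K := by
  rw [numNonUndersized]
  exact (card_le_univ _).trans (Fintype.card_fin K).le

theorem mul_powerFrom_le {k : Fin K} (hk : (k : ℕ) < numNonUndersized N n p) :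
    n k * powerFrom p k ≤ ((N : ℝ) - servedStreams n k) * p k := by
  rw [← not_undersized_iff hn hp hord, undersized_iff_mul_lt hp] at hk
  exact not_lt.1 hk

theorem servedStreams_numNonUndersized_le :
    servedStreams n (numNonUndersized N n p) ≤ N := by
  rcases Nat.eq_zero_or_pos (numNonUndersized N n p) with h0 | hpos
  · simp [h0, servedStreams]
  · obtain ⟨j, hj⟩ := Nat.exists_eq_succ_of_ne_zero hpos.ne'
    have hjK : j < K := by have := numNonUndersized_le (N := N) (n := n) (p := p); omega
    have h := mul_powerFrom_le hn hp hord (N := N) (k := ⟨j, hjK⟩) (by simp only; omega)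
    rw [hj, Nat.succ_eq_add_one, servedStreams_succ n ⟨j, hjK⟩]
    have h1 := powerFrom_eq p ⟨j, hjK⟩
    have h2 := powerFrom_nonneg p hp (j + 1)
    have h3 := hp ⟨j, hjK⟩
    simp only at h h1 h2 h3 ⊢
    have h4 : (n ⟨j, hjK⟩ : ℝ) * p ⟨j, hjK⟩ ≤ ((N : ℝ) - servedStreams n j) * p ⟨j, hjK⟩ := by
      refine le_trans ?_ h
      rw [h1, mul_add]
      have : (0 : ℝ) ≤ n ⟨j, hjK⟩ * powerFrom p (j + 1) := by positivity
      linarith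
    have h5 := le_of_mul_le_mul_right h4 h3
    have : ((servedStreams n j + n ⟨j, hjK⟩ : ℕ) : ℝ) ≤ N := by push_cast; linarith
    exact_mod_cast this

/-- The last non-undersized user leaves room for the positive power behind it. This keeps the
denominator of `floorLevel` positive. -/
theorem servedStreams_numNonUndersized_lt (hN : 1 ≤ N) (hK : numNonUndersized N n p < K) :
    servedStreams n (numNonUndersized N n p) < N := by
  rcases Nat.eq_zero_or_pos (numNonUndersized N n p) with h0 | hpos
  · simp [h0, servedStreams]; omega
  · obtain ⟨j, hj⟩ := Nat.exists_eq_succ_of_ne_zero hpos.ne'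
    have hjK : j < K := by omega
    have h := mul_powerFrom_le hn hp hord (N := N) (k := ⟨j, hjK⟩) (by simp only; omega)
    rw [hj, Nat.succ_eq_add_one] at hK ⊢
    rw [servedStreams_succ n ⟨j, hjK⟩]
    have h1 := powerFrom_eq p ⟨j, hjK⟩
    have h2 := powerFrom_pos p hp hK
    have h3 := hp ⟨j, hjK⟩
    have h6 : (0 : ℝ) < n ⟨j, hjK⟩ := by exact_mod_cast hn ⟨j, hjK⟩
    simp only at h h1 h2 h3 ⊢
    have h4 : (n ⟨j, hjK⟩ : ℝ) * p ⟨j, hjK⟩ < ((N : ℝ) - servedStreams n j) * p ⟨j, hjK⟩ := by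
      refine lt_of_lt_of_le ?_ h
      rw [h1, mul_add]
      have : (0 : ℝ) < n ⟨j, hjK⟩ * powerFrom p (j + 1) := by positivity
      linarith
    have h5 := lt_of_mul_lt_mul_right h4 h3.le
    have : ((servedStreams n j + n ⟨j, hjK⟩ : ℕ) : ℝ) < N := by push_cast; linarith
    exact_mod_cast this

end Users

/-! ### The optimal eigenvalues and the dimension shares. -/

section Levels

variable (N : ℕ) {K : ℕ} (n : Fin K → ℕ) (p : Fin K → ℝ)

/-- The eigenvalue of an optimal signal correlation matrix on the dimensions that the undersized
users share. -/
noncomputable def floorLevel : ℝ :=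
  N * powerFrom p (numNonUndersized N n p) / (N - servedStreams n (numNonUndersized N n p))

/-- The eigenvalue of an optimal signal correlation matrix on the dimensions used by user `j`. -/
noncomputable def level (j : ℕ) : ℝ :=
  if h : j < K ∧ j < numNonUndersized N n p then N * (p ⟨j, h.1⟩ / n ⟨j, h.1⟩)
  else floorLevel N n p

/-- The number of dimensions of the signal space that user `k` takes up. -/
noncomputable def dimShare (k : Fin K) : ℝ :=
  if (k : ℕ) < numNonUndersized N n p then n k
  else ((N : ℝ) - servedStreams n (numNonUndersized N n p)) *
    (p k / powerFrom p (numNonUndersized N n p))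

/-- The decreasing sequence of the eigenvalues of an optimal signal correlation matrix. -/
noncomputable def optimalEigenvalue (i : ℕ) : ℝ :=
  level N n p (blockIndex (fun j => if h : j < K then n ⟨j, h⟩ else 0) (numNonUndersized N n p) i)

variable {N n p}

theorem maxOrthogonal_eq (k : Fin K) : maxOrthogonal N n p k = ⌊dimShare N n p k⌋₊ := by
  rw [maxOrthogonal, dimShare]
  split_ifs with h
  · rw [Nat.floor_natCast]
  · rw [servedStreams, Nat.cast_sum, powerFrom]

theorem level_of_lt {k : Fin K} (hk : (k : ℕ) < numNonUndersized N n p) :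
    level N n p k = N * (p k / n k) := by
  rw [level, dif_pos ⟨k.2, hk⟩]

theorem level_of_le {j : ℕ} (hj : numNonUndersized N n p ≤ j) :
    level N n p j = floorLevel N n p := by
  rw [level, dif_neg (by omega)]

variable (hN : 1 ≤ N) (hn : ∀ k, 1 ≤ n k) (hp : ∀ k, 0 < p k)
  (hord : ∀ k k' : Fin K, k ≤ k' → p k' / (n k' : ℝ) ≤ p k / (n k : ℝ))

include hn hp hord

theorem floorLevel_nonneg : 0 ≤ floorLevel N n p := by
  have h1 := servedStreams_numNonUndersized_le hn hp hord (N := N)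
  have h2 : (servedStreams n (numNonUndersized N n p) : ℝ) ≤ N := by exact_mod_cast h1
  exact div_nonneg (mul_nonneg (Nat.cast_nonneg _) (powerFrom_nonneg p hp _)) (by linarith)

include hN in
theorem floorLevel_pos (hK : numNonUndersized N n p < K) : 0 < floorLevel N n p := by
  have h1 := servedStreams_numNonUndersized_lt hn hp hord hN hK
  have h2 : (servedStreams n (numNonUndersized N n p) : ℝ) < N := by exact_mod_cast h1
  have h3 : (0 : ℝ) < N := by exact_mod_cast hN
  exact div_pos (mul_pos h3 (powerFrom_pos p hp hK)) (by linarith)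

include hN in
theorem floorLevel_le_level (j : ℕ) : floorLevel N n p ≤ level N n p j := by
  by_cases hj : j < K ∧ j < numNonUndersized N n p
  · obtain ⟨l, hl⟩ : ∃ l, numNonUndersized N n p = l + 1 :=
      ⟨numNonUndersized N n p - 1, by omega⟩
    have hlK : l < K := by have := numNonUndersized_le (N := N) (n := n) (p := p); omega
    have hle : level N n p l ≤ level N n p j := by
      rw [level_of_lt (k := ⟨l, hlK⟩) (by simp only; omega), level_of_lt (k := ⟨j, hj.1⟩) hj.2]
      exact mul_le_mul_of_nonneg_left (hord ⟨j, hj.1⟩ ⟨l, hlK⟩ (by rw [Fin.le_def]; simp only; omega))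
        (Nat.cast_nonneg _)
    refine le_trans ?_ hle
    -- That the last non-undersized user is not undersized rearranges to its level being at least
    -- `floorLevel`. With no undersized user, `floorLevel` is zero.
    rcases lt_or_ge (numNonUndersized N n p) K with hK | hK
    · have h1 := servedStreams_numNonUndersized_lt hn hp hord hN hK
      have h2 : (servedStreams n (numNonUndersized N n p) : ℝ) < N := by exact_mod_cast h1
      have h3 : (0 : ℝ) < n ⟨l, hlK⟩ := by exact_mod_cast hn ⟨l, hlK⟩
      have h := mul_powerFrom_le hn hp hord (N := N) (k := ⟨l, hlK⟩) (by simp only; omega)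
      have h4 := powerFrom_eq p ⟨l, hlK⟩
      have h5 := servedStreams_succ n ⟨l, hlK⟩
      rw [level_of_lt (k := ⟨l, hlK⟩) (by simp only; omega), floorLevel, mul_div_assoc]
      refine mul_le_mul_of_nonneg_left ?_ (Nat.cast_nonneg _)
      rw [div_le_div_iff₀ (by linarith) h3, hl]
      simp only at h h4 h5
      rw [h5]
      push_cast
      rw [h4] at h
      linarith
    · rw [floorLevel, powerFrom_of_le p hK, mul_zero, zero_div,
        level_of_lt (k := ⟨l, hlK⟩) (by simp only; omega)]
      have := (hp ⟨l, hlK⟩).le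
      positivity
  · rw [level, dif_neg hj]

include hN in
theorem antitone_level : Antitone (level N n p) := by
  intro i j hij
  by_cases hj : j < K ∧ j < numNonUndersized N n p
  · rw [level_of_lt (k := ⟨j, hj.1⟩) hj.2, level_of_lt (k := ⟨i, by omega⟩) (by simp only; omega)]
    exact mul_le_mul_of_nonneg_left (hord ⟨i, by omega⟩ ⟨j, hj.1⟩ hij) (Nat.cast_nonneg _)
  · rw [level, dif_neg hj]
    exact floorLevel_le_level hN hn hp hord i

include hN in
theorem antitone_optimalEigenvalue : Antitone (optimalEigenvalue N n p) := fun _ _ hij =>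
  antitone_level hN hn hp hord (monotone_blockIndex hij)

include hN in
theorem floorLevel_le_optimalEigenvalue (i : ℕ) : floorLevel N n p ≤ optimalEigenvalue N n p i :=
  floorLevel_le_level hN hn hp hord _

include hN in
theorem optimalEigenvalue_nonneg (i : ℕ) : 0 ≤ optimalEigenvalue N n p i :=
  (floorLevel_nonneg hn hp hord).trans (floorLevel_le_optimalEigenvalue hN hn hp hord i)

theorem sum_optimalEigenvalue_comp (g : ℝ → ℝ) :
    ∑ i ∈ range N, g (optimalEigenvalue N n p i) =
      ∑ k with ((k : Fin K) : ℕ) < numNonUndersized N n p, n k * g (level N n p k) +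
        ((N : ℝ) - servedStreams n (numNonUndersized N n p)) * g (floorLevel N n p) := by
  have hm := sum_filter_lt_eq_sum_range n (g := fun j => if h : j < K then n ⟨j, h⟩ else 0)
    (fun k => by simp) (numNonUndersized_le (N := N) (n := n) (p := p))
  have hle := servedStreams_numNonUndersized_le hn hp hord (N := N)
  rw [servedStreams, hm] at hle
  have := sum_range_blockIndex_total (fun j => g (level N n p j)) hle
  simp only [optimalEigenvalue]
  rw [this, level_of_le le_rfl, servedStreams, hm, Nat.cast_sum,
    sum_filter_lt_eq_sum_range (fun k : Fin K => (n k : ℝ) * g (level N n p k))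
      (g := fun j => ((if h : j < K then n ⟨j, h⟩ else 0 : ℕ) : ℝ) * g (level N n p j))
      (fun k => by simp) (numNonUndersized_le (N := N) (n := n) (p := p))]

omit hp hord in
theorem sum_mul_level {j : ℕ} (hj : j ≤ numNonUndersized N n p) :
    ∑ k with ((k : Fin K) : ℕ) < j, n k * level N n p k = N * powerBefore p j := by
  rw [powerBefore, mul_sum]
  refine sum_congr rfl fun k hk => ?_
  have hk' := (mem_filter.1 hk).2
  have : (n k : ℝ) ≠ 0 := by have := hn k; positivity
  rw [level_of_lt (by omega)]
  field_simp

omit hp hord in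
-- At the ends of blocks the Ky Fan constraints hold with equality.
theorem sum_optimalEigenvalue_servedStreams {j : ℕ} (hj : j ≤ numNonUndersized N n p) :
    ∑ i ∈ range (servedStreams n j), optimalEigenvalue N n p i = N * powerBefore p j := by
  have hjK := hj.trans (numNonUndersized_le (N := N) (n := n) (p := p))
  rw [← sum_mul_level hn hj, servedStreams,
    sum_filter_lt_eq_sum_range n (g := fun j => if h : j < K then n ⟨j, h⟩ else 0)
      (fun k => by simp) hjK,
    sum_filter_lt_eq_sum_range (fun k : Fin K => (n k : ℝ) * level N n p k)
      (g := fun j => ((if h : j < K then n ⟨j, h⟩ else 0 : ℕ) : ℝ) * level N n p j)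
      (fun k => by simp) hjK]
  exact sum_range_blockIndex (level N n p) hj

omit hn hp hord in
theorem exists_servedStreams_eq {i : ℕ}
    (h : optimalEigenvalue N n p i ≠ optimalEigenvalue N n p (i + 1)) :
    ∃ j ≤ numNonUndersized N n p, servedStreams n j = i + 1 := by
  obtain ⟨j, hj, hji⟩ := exists_sum_eq_of_blockIndex_ne
    (m := fun j => if h : j < K then n ⟨j, h⟩ else 0) (L := numNonUndersized N n p) (i := i)
    (fun he => h (by rw [optimalEigenvalue, optimalEigenvalue, he]))
  refine ⟨j, hj, ?_⟩
  rw [← hji]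
  exact sum_filter_lt_eq_sum_range n (fun k => by simp)
    (hj.trans (numNonUndersized_le (N := N) (n := n) (p := p)))

include hN in
theorem mul_floorLevel :
    ((N : ℝ) - servedStreams n (numNonUndersized N n p)) * floorLevel N n p =
      N * powerFrom p (numNonUndersized N n p) := by
  rcases lt_or_ge (numNonUndersized N n p) K with hK | hK
  · have h1 := servedStreams_numNonUndersized_lt hn hp hord hN hK
    have h2 : (servedStreams n (numNonUndersized N n p) : ℝ) < N := by exact_mod_cast h1
    rw [floorLevel, mul_div_cancel₀]
    linarith
  · rw [floorLevel, powerFrom_of_le p hK]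
    simp

include hN in
theorem sum_optimalEigenvalue :
    ∑ i ∈ range N, optimalEigenvalue N n p i = N * ∑ k, p k := by
  have := sum_optimalEigenvalue_comp hn hp hord (N := N) id
  simp only [id] at this
  rw [this, sum_mul_level hn le_rfl, mul_floorLevel hN hn hp hord,
    ← powerBefore_add_powerFrom p (numNonUndersized N n p)]
  ring

include hN in
theorem dimShare_pos (k : Fin K) : 0 < dimShare N n p k := by
  rw [dimShare]
  split_ifs with h
  · exact_mod_cast hn k
  · have hK : numNonUndersized N n p < K := by have := k.2; omega
    have h1 := servedStreams_numNonUndersized_lt hn hp hord hN hK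
    have h2 : (servedStreams n (numNonUndersized N n p) : ℝ) < N := by exact_mod_cast h1
    exact mul_pos (by linarith) (div_pos (hp k) (powerFrom_pos p hp hK))

theorem dimShare_le (k : Fin K) : dimShare N n p k ≤ n k := by
  rw [dimShare]
  split_ifs with h
  · exact le_rfl
  · have hK : numNonUndersized N n p < K := by have := k.2; omega
    -- The first undersized user bounds the ratio of remaining dimensions to remaining power; the
    -- ordering carries the bound to user `k`.
    have hu : Undersized N n p ⟨_, hK⟩ := by
      by_contra hnot
      rw [not_undersized_iff hn hp hord] at hnot
      exact lt_irrefl _ hnot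
    rw [undersized_iff_mul_lt hp] at hu
    simp only at hu
    have hpos := powerFrom_pos p hp hK
    have hk : (0 : ℝ) < n k := by exact_mod_cast hn k
    have hk0 : (0 : ℝ) < n ⟨_, hK⟩ := by exact_mod_cast hn ⟨_, hK⟩
    have ho := hord ⟨_, hK⟩ k (by rw [Fin.le_def]; simp only; omega)
    rw [div_le_div_iff₀ hk hk0] at ho
    have h1 := servedStreams_numNonUndersized_le hn hp hord (N := N)
    have h2 : (servedStreams n (numNonUndersized N n p) : ℝ) ≤ N := by exact_mod_cast h1
    rw [← mul_div_assoc, div_le_iff₀ hpos, ← mul_le_mul_iff_right₀ hk0]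
    calc (n ⟨_, hK⟩ : ℝ) * (((N : ℝ) - servedStreams n (numNonUndersized N n p)) * p k)
        = ((N : ℝ) - servedStreams n (numNonUndersized N n p)) * (p k * n ⟨_, hK⟩) := by ring
      _ ≤ ((N : ℝ) - servedStreams n (numNonUndersized N n p)) * (p ⟨_, hK⟩ * n k) :=
          mul_le_mul_of_nonneg_left ho (by linarith)
      _ = n k * (((N : ℝ) - servedStreams n (numNonUndersized N n p)) * p ⟨_, hK⟩) := by ring
      _ ≤ n k * (n ⟨_, hK⟩ * powerFrom p (numNonUndersized N n p)) :=
          mul_le_mul_of_nonneg_left hu.le hk.le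
      _ = _ := by ring

include hN in
/-- Every user spends the power `level / N` in each of its dimensions. -/
theorem level_mul_dimShare (k : Fin K) : level N n p k * dimShare N n p k = N * p k := by
  rw [dimShare]
  split_ifs with h
  · rw [level_of_lt h]
    have : (n k : ℝ) ≠ 0 := by have := hn k; positivity
    field_simp
  · rw [level_of_le (not_lt.1 h), ← mul_assoc, mul_comm (floorLevel N n p),
      mul_floorLevel hN hn hp hord]
    have : powerFrom p (numNonUndersized N n p) ≠ 0 :=
      (powerFrom_pos p hp (by have := k.2; omega)).ne'
    field_simp

omit hn hord in
-- Without undersized users the shares sum to the number of streams, which may be less than `N`.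
theorem sum_dimShare (hK : numNonUndersized N n p < K) : ∑ k, dimShare N n p k = N := by
  have hpos := (powerFrom_pos p hp hK).ne'
  rw [← sum_filter_add_sum_filter_not univ (fun k : Fin K => (k : ℕ) < numNonUndersized N n p),
    sum_congr rfl (g := fun k => (n k : ℝ)) fun k hk => by
      rw [dimShare, if_pos (mem_filter.1 hk).2],
    sum_congr rfl (s₁ := {k : Fin K | ¬ (k : ℕ) < numNonUndersized N n p})
      (g := fun k => ((N : ℝ) - servedStreams n (numNonUndersized N n p)) *
        (p k / powerFrom p (numNonUndersized N n p))) fun k hk => by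
      rw [dimShare, if_neg (mem_filter.1 hk).2],
    ← mul_sum, ← sum_div]
  simp only [not_lt]
  change _ + _ * (powerFrom p _ / _) = _
  rw [div_self hpos, servedStreams, Nat.cast_sum]
  ring

end Levels

end MultiCodeCDMA

/-! ### Upper bounds on the sum rate and on the number of orthogonal sequences. -/

namespace MultiCodeCDMA

open Finset Matrix

theorem rank_add_le {m : Type*} [Fintype m] (A B : Matrix m m ℝ) :
    (A + B).rank ≤ A.rank + B.rank := by
  rw [rank, rank, rank, mulVecLin_add]
  refine (Submodule.finrank_mono ?_).trans (Submodule.finrank_add_le_finrank_add_finrank _ _)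
  rintro _ ⟨v, rfl⟩
  exact Submodule.add_mem_sup ⟨v, rfl⟩ ⟨v, rfl⟩

namespace System

variable {N K : ℕ} {n : Fin K → ℕ} {p : Fin K → ℝ} {σ : ℝ} {c : System N K n}

/-- The correlation matrix of the signal of all users. -/
def totalCov (c : System N K n) : Matrix (Fin N) (Fin N) ℝ := ∑ k, c.signalCov k

theorem Feasible.posSemidef_signalCov (hc : c.Feasible p) (k : Fin K) :
    (c.signalCov k).PosSemidef := by
  have := (hc k).1.mul_mul_conjTranspose_same (c.S k)
  rwa [conjTranspose_eq_transpose_of_trivial] at this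

theorem Feasible.posSemidef_sum_signalCov (hc : c.Feasible p) (I : Finset (Fin K)) :
    (∑ k ∈ I, c.signalCov k).PosSemidef :=
  posSemidef_sum I fun k _ => hc.posSemidef_signalCov k

theorem Feasible.posSemidef_totalCov (hc : c.Feasible p) : c.totalCov.PosSemidef :=
  hc.posSemidef_sum_signalCov univ

theorem Feasible.trace_signalCov (hN : 1 ≤ N) (hc : c.Feasible p) (k : Fin K) :
    (c.signalCov k).trace = N * p k := by
  have : (N : ℝ) ≠ 0 := by positivity
  rw [← (hc k).2]
  field_simp

theorem rank_sum_signalCov_le (c : System N K n) (I : Finset (Fin K)) :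
    (∑ k ∈ I, c.signalCov k).rank ≤ ∑ k ∈ I, n k := by
  induction I using Finset.induction_on with
  | empty => simp
  | insert k I hk ih =>
    rw [sum_insert hk, sum_insert hk]
    refine (rank_add_le _ _).trans (Nat.add_le_add ?_ ih)
    rw [signalCov, Matrix.mul_assoc]
    exact (rank_mul_le_left _ _).trans (rank_le_width _)

theorem sumRate_le_sumRate_iff (hN : 1 ≤ N) (hσ : 0 < σ) {c c' : System N K n}
    (hc : c.Feasible p) (hc' : c'.Feasible p) :
    c.sumRate σ ≤ c'.sumRate σ ↔
      Real.log (1 + (1 / σ ^ 2) • c.totalCov).det ≤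
        Real.log (1 + (1 / σ ^ 2) • c'.totalCov).det := by
  have hN' : (0 : ℝ) < N := by exact_mod_cast hN
  have hs : 0 < 1 / σ ^ 2 := by positivity
  have h1 := det_one_add_smul_pos hc.posSemidef_totalCov hs
  have h2 := det_one_add_smul_pos hc'.posSemidef_totalCov hs
  rw [Real.log_le_log_iff h1 h2, sumRate, sumRate, mul_le_mul_iff_right₀ (by positivity)]
  exact Real.logb_le_logb one_lt_two h1 h2

section Majorization

variable (hN : 1 ≤ N) (hn : ∀ k, 1 ≤ n k) (hp : ∀ k, 0 < p k)
  (hord : ∀ k k' : Fin K, k ≤ k' → p k' / (n k' : ℝ) ≤ p k / (n k : ℝ)) (hc : c.Feasible p)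

include hN

theorem Feasible.sum_sortedEigenvalues (hc : c.Feasible p) :
    ∑ i ∈ range N, sortedEigenvalues hc.posSemidef_totalCov.1 i = N * ∑ k, p k := by
  rw [sum_range_sortedEigenvalues_eq_trace, totalCov, trace_sum, mul_sum]
  exact sum_congr rfl fun k _ => hc.trace_signalCov hN k

/-- Ky Fan applied to the covariance of the first `j` users, whose rank is at most the number of
their streams. -/
theorem Feasible.mul_powerBefore_le (hc : c.Feasible p) {j : ℕ} (hj : servedStreams n j ≤ N) :
    N * powerBefore p j ≤
      ∑ i ∈ range (servedStreams n j), sortedEigenvalues hc.posSemidef_totalCov.1 i := by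
  have hsplit : c.totalCov = ∑ k with ((k : Fin K) : ℕ) < j, c.signalCov k +
      ∑ k with ¬ ((k : Fin K) : ℕ) < j, c.signalCov k :=
    (sum_filter_add_sum_filter_not _ _ _).symm
  have hZ := hc.posSemidef_totalCov
  have h := trace_le_sum_sortedEigenvalues (hc.posSemidef_sum_signalCov _)
    (hc.posSemidef_sum_signalCov _) (hsplit ▸ hZ) hj (c.rank_sum_signalCov_le _)
  rw [trace_sum, sum_congr rfl fun k _ => hc.trace_signalCov hN k, ← mul_sum] at h
  simp only [← hsplit] at h
  exact h

include hn hp hord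

theorem Feasible.sum_optimalEigenvalue_le (hc : c.Feasible p) {i : ℕ}
    (hi : optimalEigenvalue N n p i ≠ optimalEigenvalue N n p (i + 1)) :
    ∑ m ∈ range (i + 1), optimalEigenvalue N n p m ≤
      ∑ m ∈ range (i + 1), sortedEigenvalues hc.posSemidef_totalCov.1 m := by
  obtain ⟨j, hj, hji⟩ := exists_servedStreams_eq hi
  have hle : servedStreams n j ≤ N := by
    refine le_trans ?_ (servedStreams_numNonUndersized_le hn hp hord (N := N))
    exact sum_le_sum_of_subset (monotone_filter_right _ fun k _ hk => lt_of_lt_of_le hk hj)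
  rw [← hji, sum_optimalEigenvalue_servedStreams hn hj]
  exact hc.mul_powerBefore_le hN hle

theorem Feasible.log_det_le (hc : c.Feasible p) (hσ : 0 < σ) :
    Real.log (1 + (1 / σ ^ 2) • c.totalCov).det ≤
      ∑ i ∈ range N, Real.log (1 + 1 / σ ^ 2 * optimalEigenvalue N n p i) := by
  have hs : 0 < 1 / σ ^ 2 := by positivity
  rw [log_det_one_add_smul hc.posSemidef_totalCov hs]
  exact sum_log_le_of_majorizes hs (sortedEigenvalues_nonneg hc.posSemidef_totalCov)
    (optimalEigenvalue_nonneg hN hn hp hord) (antitone_optimalEigenvalue hN hn hp hord)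
    (by rw [hc.sum_sortedEigenvalues hN, sum_optimalEigenvalue hN hn hp hord])
    fun i _ hi => hc.sum_optimalEigenvalue_le hN hn hp hord hi

/-- The hypothesis is the equality case of the rate bound, which fixes the whole spectrum; only its
lower bound is needed. -/
theorem Feasible.floorLevel_le_eigenvalues (hc : c.Feasible p) (hσ : 0 < σ)
    (h : ∑ i ∈ range N, Real.log (1 + 1 / σ ^ 2 * optimalEigenvalue N n p i) ≤
      Real.log (1 + (1 / σ ^ 2) • c.totalCov).det) (i : Fin N) :
    floorLevel N n p ≤ hc.posSemidef_totalCov.1.eigenvalues i := by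
  have hs : 0 < 1 / σ ^ 2 := by positivity
  rw [log_det_one_add_smul hc.posSemidef_totalCov hs] at h
  rw [← sortedEigenvalues_eigenvalueRank, eq_of_sum_log_eq_of_majorizes hs
    (sortedEigenvalues_nonneg hc.posSemidef_totalCov)
    (optimalEigenvalue_nonneg hN hn hp hord) (antitone_optimalEigenvalue hN hn hp hord)
    (by rw [hc.sum_sortedEigenvalues hN, sum_optimalEigenvalue hN hn hp hord])
    (fun i _ hi => hc.sum_optimalEigenvalue_le hN hn hp hord hi) h (Fin.is_lt _)]
  exact floorLevel_le_optimalEigenvalue hN hn hp hord _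

end Majorization

section Orthogonal

theorem Normalized.signalCov_apply (hc : c.Normalized) (k : Fin K) (i i' : Fin N) :
    c.signalCov k i i' = ∑ l, c.S k i l * c.P k l l * c.S k i' l := by
  rw [signalCov, mul_apply]
  refine sum_congr rfl fun l _ => ?_
  rw [mul_apply, sum_eq_single l, transpose_apply]
  · intro l' _ hl'
    rw [(hc k).1 hl', mul_zero]
  · simp

theorem Normalized.trace_signalCov (hc : c.Normalized) (k : Fin K) :
    (c.signalCov k).trace = N * ∑ l, c.P k l l := by
  simp only [trace, diag_apply, hc.signalCov_apply]
  rw [sum_comm, mul_sum]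
  refine sum_congr rfl fun l _ => ?_
  rw [← (hc k).2 l, sum_mul]
  exact sum_congr rfl fun i _ => by ring

/-- An active orthogonal signature sequence is an eigenvector of the correlation matrix. -/
theorem Normalized.totalCov_mulVec (hc : c.Normalized) (hf : c.Feasible p)
    {j : Σ k : Fin K, Fin (n k)} (hj : c.IsActiveOrthogonal j) :
    (c.totalCov *ᵥ fun i => c.S j.1 i j.2) = (N * c.P j.1 j.2 j.2) • fun i => c.S j.1 i j.2 := by
  ext i
  have h : (c.totalCov *ᵥ fun i => c.S j.1 i j.2) i = ∑ x : Σ k : Fin K, Fin (n k),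
      c.S x.1 i x.2 * c.P x.1 x.2 x.2 * ∑ i', c.S j.1 i' j.2 * c.S x.1 i' x.2 := by
    rw [Fintype.sum_sigma, mulVec, dotProduct]
    simp only [totalCov, Matrix.sum_apply, hc.signalCov_apply, sum_mul, mul_sum]
    rw [sum_comm]
    refine sum_congr rfl fun k _ => ?_
    rw [sum_comm]
    exact sum_congr rfl fun l _ => sum_congr rfl fun i' _ => by ring
  rw [h, sum_eq_single j]
  · have : ∑ i', c.S j.1 i' j.2 * c.S j.1 i' j.2 = N := by
      rw [← (hc j.1).2 j.2]
      exact sum_congr rfl fun i' _ => by ring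
    rw [this, Pi.smul_apply, smul_eq_mul]
    ring
  · intro x _ hx
    by_cases ha : c.Active x
    · rw [hj.2 x hx ha, mul_zero]
    -- Inactive streams need not be orthogonal to `j`, but they have zero power.
    · have h0 : 0 ≤ c.P x.1 x.2 x.2 := (hf x.1).1.diag_nonneg
      rw [le_antisymm (not_lt.1 ha) h0, mul_zero, zero_mul]
  · simp

/-- Each orthogonal sequence uses at least `μ` of the trace `N * p k` of the user's covariance. -/
theorem Normalized.mul_numOrthogonal_le (hN : 1 ≤ N) (hc : c.Normalized) (hf : c.Feasible p)
    {μ : ℝ} (hμ : ∀ i, μ ≤ hf.posSemidef_totalCov.1.eigenvalues i) (k : Fin K) :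
    μ * c.numOrthogonal k ≤ N * p k := by
  classical
  have hN' : (0 : ℝ) < N := by exact_mod_cast hN
  rw [← hf.trace_signalCov hN k, hc.trace_signalCov, mul_sum, numOrthogonal]
  set I : Finset (Fin (n k)) := {l | c.IsActiveOrthogonal ⟨k, l⟩} with hI
  have h1 : ∀ l ∈ I, μ ≤ N * c.P k l l := fun l hl => by
    have hne : (fun i => c.S k i l) ≠ 0 := fun h0 => by
      have := (hc k).2 l
      rw [sum_eq_zero fun i _ => by rw [congrFun h0 i]; simp] at this
      exact hN'.ne this
    obtain ⟨i, hi⟩ := eigenvalue_of_mulVec_eq hf.posSemidef_totalCov.1 hne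
      (hc.totalCov_mulVec hf (mem_filter.1 hl).2)
    exact (hμ i).trans hi.le
  calc μ * (#{l : Fin (n k) | c.IsActiveOrthogonal ⟨k, l⟩} : ℝ) = ∑ l ∈ I, μ := by
        rw [sum_const, nsmul_eq_mul, mul_comm]
    _ ≤ ∑ l ∈ I, N * c.P k l l := sum_le_sum h1
    _ ≤ ∑ l, N * c.P k l l := sum_le_sum_of_subset_of_nonneg (subset_univ _) fun l _ _ =>
        mul_nonneg hN'.le (hf k).1.diag_nonneg

theorem numOrthogonal_le (c : System N K n) (k : Fin K) : c.numOrthogonal k ≤ n k := by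
  rw [numOrthogonal]
  exact (card_le_univ _).trans (Fintype.card_fin _).le

end Orthogonal

end System

end MultiCodeCDMA

/-! ### Construction of an optimal system. -/

namespace MultiCodeCDMA

open Finset Matrix

section Construction

/-- Summand `l` is the length of the part of `[0, x]` inside `[l, l + 1]`. -/
theorem sum_range_clamp {x : ℝ} (hx : 0 ≤ x) (m : ℕ) :
    ∑ l ∈ range m, max 0 (min 1 (x - l)) = min x m := by
  induction m with
  | zero => simp [hx]
  | succ m ih =>
    rw [sum_range_succ, ih]
    push_cast
    rcases le_total x m with h | h
    · rw [min_eq_left h, min_eq_left (by linarith : x ≤ m + 1),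
        max_eq_left ((min_le_right _ _).trans (by linarith)), add_zero]
    · rw [min_eq_right h, max_eq_right (le_min zero_le_one (by linarith)),
        ← min_add_add_left, add_sub_cancel, min_comm]

/-- Splitting off the level `μ` leaves a perturbation supported on orthonormal columns, and
Sylvester's determinant identity makes it diagonal. The factor `μ` in `hV` means that nothing is
asked of `V * Vᵀ` when `μ = 0`. -/
theorem det_one_add_smul_frame {m J : Type*} [Fintype m] [DecidableEq m] [Fintype J]
    [DecidableEq J] {V : Matrix m J ℝ} {e : J → ℝ} {μ s : ℝ} (hsμ : 0 < 1 + s * μ)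
    (hV : μ • (V * Vᵀ) = μ • (1 : Matrix m m ℝ))
    (horth : ∀ j, e j ≠ μ → ∀ k, (Vᵀ * V) j k = if j = k then 1 else 0) :
    (1 + s • (V * diagonal e * Vᵀ)).det =
      (1 + s * μ) ^ Fintype.card m * ∏ j, ((1 + s * e j) / (1 + s * μ)) := by
  set D : Matrix J J ℝ := diagonal fun j => s * (e j - μ) / (1 + s * μ) with hD
  have h1 : 1 + s • (V * diagonal e * Vᵀ) = (1 + s * μ) • (1 + V * (D * Vᵀ)) := by
    have he : s • diagonal e = (1 + s * μ) • D + (s * μ) • (1 : Matrix J J ℝ) := by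
      ext j k
      by_cases hjk : j = k
      · subst hjk
        simp only [hD, Matrix.smul_apply, Matrix.add_apply, diagonal_apply_eq, one_apply_eq,
          smul_eq_mul]
        field_simp
        ring
      · simp [hD, hjk]
    rw [← Matrix.smul_mul, ← Matrix.mul_smul, he, Matrix.mul_add, Matrix.add_mul, Matrix.mul_smul,
      Matrix.mul_smul, Matrix.mul_one, Matrix.smul_mul, Matrix.smul_mul, SemigroupAction.mul_smul s μ,
      hV, smul_add, add_smul 1 (s * μ) (1 : Matrix m m ℝ), one_smul, ← SemigroupAction.mul_smul, Matrix.mul_assoc]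
    abel
  have h2 : D * Vᵀ * V = D := by
    ext j k
    rw [Matrix.mul_assoc, hD, diagonal_mul]
    by_cases hj : e j = μ
    · by_cases hjk : j = k
      · subst hjk; simp [hj]
      · simp [hj, hjk]
    · rw [horth j hj k]
      by_cases hjk : j = k
      · subst hjk; simp
      · simp [hjk]
  rw [h1, det_smul, det_one_add_mul_comm, h2, hD, ← diagonal_one, diagonal_add, det_diagonal]
  congr 1
  refine prod_congr rfl fun j _ => ?_
  field_simp
  ring

variable {N K : ℕ} {n : Fin K → ℕ} {p : Fin K → ℝ}

/-- The dimension share of each user, filled up stream by stream with at most one dimension each. -/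
noncomputable def streamShare (N : ℕ) (n : Fin K → ℕ) (p : Fin K → ℝ)
    (j : Σ k : Fin K, Fin (n k)) : ℝ :=
  max 0 (min 1 (dimShare N n p j.1 - (j.2 : ℕ)))

theorem streamShare_nonneg (j : Σ k : Fin K, Fin (n k)) : 0 ≤ streamShare N n p j :=
  le_max_left _ _

theorem streamShare_le_one (j : Σ k : Fin K, Fin (n k)) : streamShare N n p j ≤ 1 :=
  max_le zero_le_one (min_le_left _ _)

theorem streamShare_eq_one {j : Σ k : Fin K, Fin (n k)}
    (h : ((j.2 : ℕ) : ℝ) + 1 ≤ dimShare N n p j.1) : streamShare N n p j = 1 := by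
  rw [streamShare, min_eq_left (by linarith), max_eq_right zero_le_one]

theorem streamShare_eq_one_of_lt {j : Σ k : Fin K, Fin (n k)}
    (h : (j.1 : ℕ) < numNonUndersized N n p) : streamShare N n p j = 1 := by
  refine streamShare_eq_one ?_
  rw [dimShare, if_pos h]
  exact_mod_cast j.2.2

variable (hN : 1 ≤ N) (hn : ∀ k, 1 ≤ n k) (hp : ∀ k, 0 < p k)
  (hord : ∀ k k' : Fin K, k ≤ k' → p k' / (n k' : ℝ) ≤ p k / (n k : ℝ))

include hN hn hp hord

theorem sum_streamShare (k : Fin K) :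
    ∑ l : Fin (n k), streamShare N n p ⟨k, l⟩ = dimShare N n p k := by
  simp only [streamShare]
  rw [Fin.sum_univ_eq_sum_range (fun l => max 0 (min 1 (dimShare N n p k - (l : ℕ)))),
    sum_range_clamp (dimShare_pos hN hn hp hord k).le, min_eq_left (dimShare_le hn hp hord k)]

/-- The factor `floorLevel` unites two cases: orthonormal rows if some user is undersized, and
otherwise distinct coordinate vectors, which need not span but have `floorLevel` zero. -/
theorem exists_frame : ∃ V : Matrix (Fin N) (Σ k : Fin K, Fin (n k)) ℝ,
    (∀ j, ∑ i, V i j ^ 2 = streamShare N n p j) ∧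
    (∀ j, streamShare N n p j = 1 → ∀ j', j' ≠ j → ∑ i, V i j * V i j' = 0) ∧
    floorLevel N n p • (V * Vᵀ) = floorLevel N n p • (1 : Matrix (Fin N) (Fin N) ℝ) := by
  classical
  rcases lt_or_ge (numNonUndersized N n p) K with hK | hK
  · obtain ⟨V, hV, hcol⟩ := exists_mul_transpose_eq_one_of_sum_eq (N := N) (streamShare N n p)
      streamShare_nonneg streamShare_le_one (by
        rw [Fintype.sum_sigma]
        simp only [sum_streamShare hN hn hp hord]
        exact sum_dimShare hp hK)
    refine ⟨V, hcol, fun j hj j' hj' => ?_, by rw [hV]⟩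
    exact sum_mul_eq_zero_of_sq_norm_eq_one hV (by rw [hcol, hj]) hj'
  · have hone : ∀ j, streamShare N n p j = 1 := fun j =>
      streamShare_eq_one_of_lt (lt_of_lt_of_le j.1.2 hK)
    have hcard : Fintype.card (Σ k : Fin K, Fin (n k)) ≤ Fintype.card (Fin N) := by
      have h := servedStreams_numNonUndersized_le hn hp hord (N := N)
      have hall : ({k | (k : ℕ) < numNonUndersized N n p} : Finset (Fin K)) = univ :=
        filter_true_of_mem fun k _ => lt_of_lt_of_le k.2 hK
      rw [servedStreams, hall] at h
      simpa using h
    obtain ⟨f⟩ := Function.Embedding.nonempty_of_card_le hcard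
    refine ⟨of fun i j => if i = f j then 1 else 0, fun j => ?_, fun j _ j' hj' => ?_, ?_⟩
    · simp [hone]
    · simp [f.injective.eq_iff, hj']
    · rw [floorLevel, powerFrom_of_le p hK]
      simp

/-- There is a normalized system with the largest possible sum rate in which every user has an
orthogonal signature sequence for each full dimension of its share. -/
theorem exists_system {σ : ℝ} (hσ : 0 < σ) : ∃ c : System N K n, c.Feasible p ∧ c.Normalized ∧
    (∑ i ∈ range N, Real.log (1 + 1 / σ ^ 2 * optimalEigenvalue N n p i) =
      Real.log (1 + (1 / σ ^ 2) • c.totalCov).det) ∧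
    ∀ k, ⌊dimShare N n p k⌋₊ ≤ c.numOrthogonal k := by
  classical
  obtain ⟨V, hcol, horth, hμ⟩ := exists_frame hN hn hp hord
  set a := streamShare N n p with ha
  set μ := floorLevel N n p with hμdef
  have hN' : (0 : ℝ) < N := by exact_mod_cast hN
  have hμ0 : 0 ≤ μ := floorLevel_nonneg hn hp hord
  have hlev : ∀ k : Fin K, 0 < level N n p k := fun k => by
    have h1 := level_mul_dimShare hN hn hp hord k
    have h2 := dimShare_pos hN hn hp hord k
    have h3 : 0 < level N n p k * dimShare N n p k := by rw [h1]; exact mul_pos hN' (hp k)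
    exact pos_of_mul_pos_left h3 h2.le
  have hV0 : ∀ j, a j = 0 → ∀ i, V i j = 0 := fun j hj i => by
    have h := hcol j
    rw [hj, sum_eq_zero_iff_of_nonneg fun i _ => sq_nonneg _] at h
    exact pow_eq_zero_iff two_ne_zero |>.1 (h i (mem_univ i))
  -- Columns of `V` are scaled to squared norm `N`, and the powers make each stream contribute
  -- `level` times `v vᵀ` for its column `v`. A stream with zero share has zero power and gets an
  -- arbitrary vector of the right norm.
  let c : System N K n :=
    { S := fun k => of fun i l =>
        if a ⟨k, l⟩ = 0 then if i = ⟨0, hN⟩ then √N else 0 else √N / √(a ⟨k, l⟩) * V i ⟨k, l⟩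
      P := fun k => diagonal fun l => level N n p k * a ⟨k, l⟩ / N }
  have hS0 : ∀ k l i, a ⟨k, l⟩ = 0 → c.S k i l = if i = ⟨0, hN⟩ then √N else 0 :=
    fun k l i h => if_pos h
  have hS1 : ∀ k l i, a ⟨k, l⟩ ≠ 0 → c.S k i l = √N / √(a ⟨k, l⟩) * V i ⟨k, l⟩ :=
    fun k l i h => if_neg h
  have hP : ∀ k l, c.P k l l = level N n p k * a ⟨k, l⟩ / N := fun k l => diagonal_apply_eq _ _
  have hnorm : c.Normalized := by
    refine fun k => ⟨isDiag_diagonal _, fun l => ?_⟩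
    by_cases h : a ⟨k, l⟩ = 0
    · simp [hS0 k l _ h]
    · have hpos : 0 < a ⟨k, l⟩ := lt_of_le_of_ne (streamShare_nonneg _) (Ne.symm h)
      simp only [hS1 k l _ h, mul_pow, ← mul_sum]
      rw [hcol, div_pow, Real.sq_sqrt hN'.le, Real.sq_sqrt hpos.le]
      field_simp
  have hcov : ∀ k i i', c.signalCov k i i' =
      ∑ l, level N n p k * V i ⟨k, l⟩ * V i' ⟨k, l⟩ := fun k i i' => by
    rw [hnorm.signalCov_apply]
    refine sum_congr rfl fun l _ => ?_
    rw [hP]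
    by_cases h : a ⟨k, l⟩ = 0
    · simp [h, hV0 _ h]
    · have hpos : 0 < a ⟨k, l⟩ := lt_of_le_of_ne (streamShare_nonneg _) (Ne.symm h)
      rw [hS1 k l i h, hS1 k l i' h]
      have e1 := Real.sq_sqrt hN'.le
      have e2 := Real.sq_sqrt hpos.le
      have e3 : 0 < √(a ⟨k, l⟩) := Real.sqrt_pos.2 hpos
      calc √N / √(a ⟨k, l⟩) * V i ⟨k, l⟩ * (level N n p k * a ⟨k, l⟩ / N) *
            (√N / √(a ⟨k, l⟩) * V i' ⟨k, l⟩)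
          = √N ^ 2 / √(a ⟨k, l⟩) ^ 2 * (a ⟨k, l⟩ / N) *
            (level N n p k * V i ⟨k, l⟩ * V i' ⟨k, l⟩) := by ring
        _ = _ := by
          rw [e1, e2]
          field_simp
  have hfeas : c.Feasible p := fun k => by
    constructor
    · refine posSemidef_diagonal_iff.2 fun l => ?_
      have := hlev k
      have := streamShare_nonneg (N := N) (p := p) (⟨k, l⟩ : Σ k : Fin K, Fin (n k))
      positivity
    · rw [hnorm.trace_signalCov]
      simp only [hP]
      rw [← sum_div, ← mul_sum, ha, sum_streamShare hN hn hp hord,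
        level_mul_dimShare hN hn hp hord]
      field_simp
  refine ⟨c, hfeas, hnorm, ?_, fun k => ?_⟩
  · have htot : c.totalCov = V *
        diagonal (fun j : Σ k : Fin K, Fin (n k) => level N n p j.1) * Vᵀ := by
      ext i i'
      simp only [System.totalCov, Matrix.sum_apply, hcov]
      rw [mul_apply, Fintype.sum_sigma]
      simp only [mul_diagonal, transpose_apply]
      exact sum_congr rfl fun k _ => sum_congr rfl fun l _ => by ring
    have hs : 0 < 1 / σ ^ 2 := by positivity
    set s := 1 / σ ^ 2
    have hsμ : 0 < 1 + s * μ := by positivity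
    have hse : ∀ k : Fin K, 0 < 1 + s * level N n p k := fun k => by
      have := hlev k
      positivity
    rw [htot, det_one_add_smul_frame hsμ hμ fun j hj j' => ?_]
    · rw [Real.log_mul (by positivity)
          (prod_pos fun j _ => div_pos (hse j.1) hsμ).ne', Real.log_pow, Real.log_prod
          (fun j _ => (div_pos (hse j.1) hsμ).ne'), Fintype.card_fin, Fintype.sum_sigma,
        sum_optimalEigenvalue_comp hn hp hord (fun x => Real.log (1 + s * x))]
      simp only [sum_const, card_univ, Fintype.card_fin, nsmul_eq_mul]
      rw [← sum_filter_add_sum_filter_not univ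
        (fun k => ((k : Fin K) : ℕ) < numNonUndersized N n p) (fun k : Fin K => (n k : ℝ) *
          Real.log ((1 + s * level N n p k) / (1 + s * μ))),
        -- Undersized users sit at the level `μ`, so their factors in the determinant are one.
        sum_eq_zero (s := {k : Fin K | ¬ _}) fun k hk => by
          rw [level_of_le (not_lt.1 (mem_filter.1 hk).2), div_self hsμ.ne', Real.log_one, mul_zero]]
      simp only [Real.log_div (hse _).ne' hsμ.ne', mul_sub, sum_sub_distrib, ← sum_mul]
      rw [servedStreams, Nat.cast_sum]
      ring
    -- A level other than `μ` belongs to a non-undersized user, all of whose streams have full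
    -- share.
    · have hj1 : a j = 1 := by
        refine streamShare_eq_one_of_lt ?_
        by_contra hle
        exact hj (level_of_le (not_lt.1 hle))
      have e : (Vᵀ * V) j j' = ∑ i, V i j * V i j' := by simp [mul_apply]
      rw [e]
      split_ifs with h
      · subst h
        rw [← hj1, ← hcol]
        exact sum_congr rfl fun i _ => by ring
      · exact horth j hj1 j' (Ne.symm h)
  · have hfl : ⌊dimShare N n p k⌋₊ ≤ n k :=
      Nat.floor_le_of_le (dimShare_le hn hp hord k)
    -- The first `⌊dimShare⌋` streams of the user have full share, hence unit columns in `V`.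
    have hsub : univ.image (Fin.castLE hfl) ⊆
        ({l | c.IsActiveOrthogonal ⟨k, l⟩} : Finset (Fin (n k))) := by
      intro l hl
      obtain ⟨r, _, rfl⟩ := mem_image.1 hl
      have h1 : a ⟨k, Fin.castLE hfl r⟩ = 1 := by
        refine streamShare_eq_one ?_
        refine le_trans ?_ (Nat.floor_le (dimShare_pos hN hn hp hord k).le)
        exact_mod_cast r.2
      refine mem_filter.2 ⟨mem_univ _, ?_, fun j' hj' hact => ?_⟩
      · change 0 < c.P k _ _
        rw [hP, h1]
        have := hlev k
        positivity
      · have h2 : a ⟨j'.1, j'.2⟩ ≠ 0 := fun h0 => by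
          have h3 : 0 < c.P j'.1 j'.2 j'.2 := hact
          rw [hP, h0, mul_zero, zero_div] at h3
          exact lt_irrefl _ h3
        simp only [hS1 _ _ _ h2, hS1 k (Fin.castLE hfl r) _ (by rw [h1]; exact one_ne_zero)]
        have h4 := horth _ h1 j' hj'
        rw [sum_congr rfl fun i _ => mul_mul_mul_comm _ _ _ _, ← mul_sum, h4, mul_zero]
    have := card_le_card hsub
    rw [card_image_of_injective _ (Fin.castLE_injective hfl), card_univ, Fintype.card_fin] at this
    rw [System.numOrthogonal]
    convert this

end Construction

theorem System.SumRateOptimal.numOrthogonal_le_maxOrthogonal {N K : ℕ} {n : Fin K → ℕ}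
    {p : Fin K → ℝ} {σ : ℝ} (hN : 1 ≤ N) (hn : ∀ k, 1 ≤ n k) (hp : ∀ k, 0 < p k) (hσ : 0 < σ)
    (hord : ∀ k k' : Fin K, k ≤ k' → p k' / (n k' : ℝ) ≤ p k / (n k : ℝ))
    {c : System N K n} (hopt : c.SumRateOptimal p σ) (hnorm : c.Normalized) (k : Fin K) :
    c.numOrthogonal k ≤ maxOrthogonal N n p k := by
  rcases lt_or_ge (k : ℕ) (numNonUndersized N n p) with hk | hk
  · rw [maxOrthogonal, if_pos hk]
    exact c.numOrthogonal_le k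
  · obtain ⟨c₀, hf₀, _, hdet₀, _⟩ := exists_system hN hn hp hord hσ
    -- Optimality against the constructed system gives the equality case of the rate bound.
    have h1 := (sumRate_le_sumRate_iff hN hσ hf₀ hopt.1).1 (hopt.2 c₀ hf₀)
    have h2 := hnorm.mul_numOrthogonal_le hN hopt.1
      (hopt.1.floorLevel_le_eigenvalues hN hn hp hord hσ (hdet₀.le.trans h1)) k
    have hpos := floorLevel_pos hN hn hp hord (lt_of_le_of_lt hk k.2)
    rw [← level_mul_dimShare hN hn hp hord, level_of_le hk] at h2
    rw [maxOrthogonal_eq]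
    exact Nat.le_floor (le_of_mul_le_mul_left h2 hpos)

end MultiCodeCDMA

theorem theorem5 (N K : ℕ) (n : Fin K → ℕ) (p : Fin K → ℝ) (σ : ℝ)
    (hN : 1 ≤ N) (hn : ∀ k, 1 ≤ n k) (hp : ∀ k, 0 < p k) (hσ : 0 < σ)
    (hord : ∀ k k' : Fin K, k ≤ k' → p k' / (n k' : ℝ) ≤ p k / (n k : ℝ)) :
    (∀ k : Fin K,
      IsGreatest
        {m : ℕ | ∃ c : MultiCodeCDMA.System N K n,
          c.SumRateOptimal p σ ∧ c.Normalized ∧ c.numOrthogonal k = m}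
        (MultiCodeCDMA.maxOrthogonal N n p k)) ∧
    (∃ c : MultiCodeCDMA.System N K n, c.SumRateOptimal p σ ∧ c.Normalized ∧
      ∀ k : Fin K, c.numOrthogonal k = MultiCodeCDMA.maxOrthogonal N n p k) := by
  obtain ⟨c, hf, hnorm, hdet, hge⟩ := MultiCodeCDMA.exists_system hN hn hp hord hσ
  have hopt : c.SumRateOptimal p σ := by
    refine ⟨hf, fun c' hf' => ?_⟩
    rw [MultiCodeCDMA.System.sumRate_le_sumRate_iff hN hσ hf' hf, ← hdet]
    exact hf'.log_det_le hN hn hp hord hσ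
  have heq : ∀ k, c.numOrthogonal k = MultiCodeCDMA.maxOrthogonal N n p k := fun k =>
    le_antisymm (hopt.numOrthogonal_le_maxOrthogonal hN hn hp hσ hord hnorm k)
      (by rw [MultiCodeCDMA.maxOrthogonal_eq]; exact hge k)
  refine ⟨fun k => ⟨⟨c, hopt, hnorm, heq k⟩, ?_⟩, c, hopt, hnorm, heq⟩
  rintro m ⟨c', hopt', hnorm', rfl⟩
  exact hopt'.numOrthogonal_le_maxOrthogonal hN hn hp hσ hord hnorm' k
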